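/- **Theorem (Contraction property).** Let $(X,d)$ be a complete metric space, $\lambda\in\mathbb{R}$, and let $\phi:X\to(-\infty,\infty]$ be lower semi-continuous with $D(\phi):=\{x:\phi(x)<\infty\}\neq\emptyset$. A minimal geodesic from $x$ to $y$ is a curve $\gamma:[0,1]\to X$ with $\gamma(0)=x$, $\gamma(1)=y$ and $d(\gamma(s),\gamma(t))=|s-t|\,d(x,y)$ for all $s,t\in[0,1]$. For a family $\Gamma$ of minimal geodesics, $\phi$ is called $\lambda$-convex along $\Gamma$ if any $x,y\in D(\phi)$ are joined by some $\gamma\in\Gamma$ from $x$ to $y$ with $$\phi(\gamma(t))\le(1-t)\phi(x)+t\phi(y)-\tfrac{\lambda}{2}(1-t)t\,d^2(x,y)\qquad(0\le t\le1).$$ For $\tau>0$ and $x\in X$ put $\phi_\tau(x):=\inf_{z\in X}\{\phi(z)+d^2(x,z)/(2\tau)\}$ and $J_\tau(x):=\{z\in X:\phi(z)+d^2(x,z)/(2\tau)=\phi_\tau(x)\}$. Assume one of the following. * **Case I.** $(X,d)$ is a $\mathrm{CAT}(1)$-space (of arbitrary diameter): any two points are joined by a minimal geodesic, and for all $x,y,z\in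 X$ with $d(x,y)+d(y,z)+d(z,x)<2\pi$ and every minimal geodesic $\gamma$ from $y$ to $z$ one has $d(x,\gamma(t))\le d_{\mathbb{S}^2}(\tilde x,\tilde\gamma(t))$ for $t\in[0,1]$, where $\triangle\tilde x\tilde y\tilde z$ is a triangle in the unit sphere $\mathbb{S}^2$ with the same side lengths as $\triangle xyz$ and $\tilde\gamma$ is the minimal geodesic from $\tilde y$ to $\tilde z$. Moreover $\phi$ is $\lambda$-convex along the family of all minimal geodesics. * **Case II.** There are a family $\Gamma$ of minimal geodesics and $K\in\mathbb{R}$ (possibly negative) such that: 1. $\phi$ is $\lambda$-convex along $\Gamma$; 2. for every $z\in X$ and every $\gamma\in\Gamma$ from $x$ to $y$, $d^2(\gamma(t),z)\le(1-t)d^2(x,z)+t\,d^2(y,z)-\frac K2(1-t)t\,d^2(x,y)$ for $t\in[0,1]$; 3. for all $\gamma,\eta\in\Gamma$ from $x$ to $y$ and from $x$ to $z$, respectively, the following limits exist and are equal: $$\lim_{s\downarrow0}\frac{d^2(\gamma(s),z)-d^2(x,z)}{s}=\lim_{t\downarrow0}\frac{d^2(\eta(t),y)-d^2(x,y)}{t};$$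 4. there is $\tau_*>0$ such that $\phi_\tau(x)>-\infty$ and $J_\tau(x)\ne\emptyset$ for all $x\in X$ and $\tau\in(0,\tau_*)$. A gradient curve of $\phi$ starting from $x_0\in D(\phi)$ is a curve $\xi:[0,\infty)\to X$ for which there are partitions $0=t_i^0<t_i^1<\cdots$, $\lim_{k\to\infty}t_i^k=\infty$ $(i\in\mathbb{N})$, with $\sup_{k\ge1}(t_i^k-t_i^{k-1})\to0$ as $i\to\infty$, and discrete solutions $x_i^0=x_0$, $x_i^k\in J_{t_i^k-t_i^{k-1}}(x_i^{k-1})$ $(k\ge1)$, such that the interpolations $\bar x_i(0):=x_0$, $\bar x_i(t):=x_i^k$ for $t\in(t_i^{k-1},t_i^k]$, converge to $\xi$ pointwise on $[0,\infty)$. Then for every $x_0\in D(\phi)$ there is exactly one gradient curve $\mathcal{G}(\cdot,x_0)$ of $\phi$ starting from $x_0$. Moreover, for all $x_0,y_0\in D(\phi)$, the curves $\xi:=\mathcal{G}(\cdot,x_0)$ and $\zeta:=\mathcal{G}(\cdot,y_0)$ satisfy $$d(\xi(t),\zeta(t))\le e^{-\lambda t}\,d(x_0,y_0)\qquad\text{for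 all }t>0.$$ -/

import Mathlib

open Filter Topology
open scoped NNReal ENNReal

noncomputable section

namespace MetricFlow

/-! ### Geodesics and `CAT(1)`-spaces -/

/-- `γ`, restricted to `[0,1]`, is a minimal geodesic from `x` to `y`
(values of `γ` outside `[0,1]` play no role). -/
def IsMinGeodesic {X : Type*} [MetricSpace X] (γ : ℝ → X) (x y : X) : Prop :=
  γ 0 = x ∧ γ 1 = y ∧
    ∀ s ∈ Set.Icc (0 : ℝ) 1, ∀ t ∈ Set.Icc (0 : ℝ) 1, dist (γ s) (γ t) = |s - t| * dist x y

/-- The ambient space of the unit sphere `S²`. -/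
abbrev E3 : Type := EuclideanSpace ℝ (Fin 3)

/-- The (angular) Riemannian distance of the unit sphere `S² ⊆ ℝ³`. -/
def sphereDist (a b : E3) : ℝ := InnerProductGeometry.angle a b

/-- `σ`, restricted to `[0,1]`, is a minimal geodesic of the unit sphere `S²` from `b` to `c`. -/
def IsSphereGeodesic (σ : ℝ → E3) (b c : E3) : Prop :=
  σ 0 = b ∧ σ 1 = c ∧ (∀ t ∈ Set.Icc (0 : ℝ) 1, σ t ∈ Metric.sphere (0 : E3) 1) ∧
    ∀ s ∈ Set.Icc (0 : ℝ) 1, ∀ t ∈ Set.Icc (0 : ℝ) 1,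
      sphereDist (σ s) (σ t) = |s - t| * sphereDist b c

/-- `a, b, c` are the vertices of a comparison triangle in `S²` of the triangle `x, y, z`. -/
def IsComparisonTriangle {X : Type*} [MetricSpace X] (x y z : X) (a b c : E3) : Prop :=
  a ∈ Metric.sphere (0 : E3) 1 ∧ b ∈ Metric.sphere (0 : E3) 1 ∧ c ∈ Metric.sphere (0 : E3) 1 ∧
    sphereDist a b = dist x y ∧ sphereDist b c = dist y z ∧ sphereDist c a = dist z x

/-- `CAT(1)`-spaces. The comparison triangle is unique up to rigid motions, and the minimal
geodesic between two of its vertices (which have distance `< π`) is unique. -/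
def IsCAT1 (X : Type*) [MetricSpace X] : Prop :=
  (∀ x y : X, ∃ γ : ℝ → X, IsMinGeodesic γ x y) ∧
    ∀ x y z : X, dist x y + dist y z + dist z x < 2 * Real.pi →
      ∀ γ : ℝ → X, IsMinGeodesic γ y z →
        ∃ (a b c : E3) (σ : ℝ → E3), IsComparisonTriangle x y z a b c ∧ IsSphereGeodesic σ b c ∧
          ∀ t ∈ Set.Icc (0 : ℝ) 1, dist x (γ t) ≤ sphereDist a (σ t)

/-! ### Semi-convexity, commutativity, coercivity -/

/-- The effective domain `D(φ)` of a function `φ : X → (-∞,∞]`. -/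
def dom {X : Type*} (φ : X → EReal) : Set X := {x | φ x ≠ ⊤}

/-- `λ`-convexity with respect to a family `Γ` of curves: any two points of `D(φ)` are joined by a
minimal geodesic in `Γ` along which the `λ`-convexity inequality holds. -/
def IsLambdaConvex {X : Type*} [MetricSpace X] (Γ : Set (ℝ → X)) (lam : ℝ) (φ : X → EReal) :
    Prop :=
  ∀ x ∈ dom φ, ∀ y ∈ dom φ, ∃ γ ∈ Γ, IsMinGeodesic γ x y ∧
    ∀ t ∈ Set.Icc (0 : ℝ) 1,
      φ (γ t) ≤ (((1 - t) * (φ x).toReal + t * (φ y).toReal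
        - lam / 2 * (1 - t) * t * dist x y ^ 2 : ℝ) : EReal)

/-- `K`-convexity of every squared distance function `d²(·, z)` along the geodesics of `Γ`. -/
def SqDistConvex {X : Type*} [MetricSpace X] (Γ : Set (ℝ → X)) (K : ℝ) : Prop :=
  ∀ γ ∈ Γ, ∀ x y : X, IsMinGeodesic γ x y → ∀ z : X, ∀ t ∈ Set.Icc (0 : ℝ) 1,
    dist (γ t) z ^ 2 ≤ (1 - t) * dist x z ^ 2 + t * dist y z ^ 2
      - K / 2 * (1 - t) * t * dist x y ^ 2

/-- Commutativity along `Γ`: for `γ, η ∈ Γ` from `x` to `y` and from `x` to `z`, respectively, the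
one-sided derivatives at `0` of `d²(γ(·), z)` and of `d²(η(·), y)` exist and coincide. -/
def SqDistCommutes {X : Type*} [MetricSpace X] (Γ : Set (ℝ → X)) : Prop :=
  ∀ γ ∈ Γ, ∀ η ∈ Γ, ∀ x y z : X, IsMinGeodesic γ x y → IsMinGeodesic η x z →
    ∃ l : ℝ,
      Tendsto (fun s : ℝ => (dist (γ s) z ^ 2 - dist x z ^ 2) / s) (𝓝[>] 0) (𝓝 l) ∧
      Tendsto (fun t : ℝ => (dist (η t) y ^ 2 - dist x y ^ 2) / t) (𝓝[>] 0) (𝓝 l)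

/-- The Moreau--Yosida approximation `φ_τ(x) = inf_z {φ(z) + d²(x,z)/(2τ)}`. -/
def moreauYosida {X : Type*} [MetricSpace X] (φ : X → EReal) (τ : ℝ) (x : X) : EReal :=
  ⨅ z : X, φ z + ((dist x z ^ 2 / (2 * τ) : ℝ) : EReal)

/-- The set `J_τ(x)` of minimizers in the Moreau--Yosida approximation. -/
def minimizers {X : Type*} [MetricSpace X] (φ : X → EReal) (τ : ℝ) (x : X) : Set X :=
  {z | φ z + ((dist x z ^ 2 / (2 * τ) : ℝ) : EReal) = moreauYosida φ τ x}

/-- Coercivity: `φ_τ(x) > -∞` and `J_τ(x) ≠ ∅` for all `x` and all sufficiently small `τ > 0`,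
uniformly in `x`. -/
def IsCoercive {X : Type*} [MetricSpace X] (φ : X → EReal) : Prop :=
  ∃ τs : ℝ, 0 < τs ∧ ∀ x : X, ∀ τ : ℝ, 0 < τ → τ < τs →
    ⊥ < moreauYosida φ τ x ∧ (minimizers φ τ x).Nonempty

/-! ### Discrete solutions and gradient curves -/

/-- A partition `0 = t⁰ < t¹ < ⋯`, `tᵏ → ∞`, of `[0,∞)`. -/
structure TimePartition where
  pt : ℕ → ℝ
  pt_zero : pt 0 = 0
  pt_strictMono : StrictMono pt
  pt_tendsto : Tendsto pt atTop atTop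

/-- The mesh `sup_k (tᵏ - tᵏ⁻¹)` (possibly infinite). -/
def TimePartition.mesh (P : TimePartition) : ℝ≥0∞ :=
  ⨆ k : ℕ, ENNReal.ofReal (P.pt (k + 1) - P.pt k)

/-- Discrete solutions of the variational scheme for `φ` with initial point `x₀`. -/
def IsDiscreteSolution {X : Type*} [MetricSpace X] (φ : X → EReal) (P : TimePartition)
    (x₀ : X) (x : ℕ → X) : Prop :=
  x 0 = x₀ ∧ ∀ k : ℕ, x (k + 1) ∈ minimizers φ (P.pt (k + 1) - P.pt k) (x k)

/-- The piecewise constant interpolation: `x⁰` at time `0` and `xᵏ` on `(tᵏ⁻¹, tᵏ]`; the index of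
time `t` is the least `k` with `t ≤ tᵏ`. -/
def TimePartition.interp {X : Type*} (P : TimePartition) (x : ℕ → X) (t : ℝ≥0) : X :=
  x (sInf {k : ℕ | (t : ℝ) ≤ P.pt k})

/-- `ξ : [0,∞) → X` is a gradient curve of `φ` starting from `x₀`: a pointwise limit of
interpolated discrete solutions starting from `x₀` whose partitions have mesh tending to `0`. -/
def IsGradientCurve {X : Type*} [MetricSpace X] (φ : X → EReal) (x₀ : X) (ξ : ℝ≥0 → X) : Prop :=
  ∃ (P : ℕ → TimePartition) (x : ℕ → ℕ → X),
    Tendsto (fun i => (P i).mesh) atTop (𝓝 0) ∧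
    (∀ i, IsDiscreteSolution φ (P i) x₀ (x i)) ∧
    ∀ t : ℝ≥0, Tendsto (fun i => (P i).interp (x i) t) atTop (𝓝 (ξ t))

end MetricFlow

end

/-! Write `f` for the real values of `φ` on its domain. If `z` minimizes `f + d²(x,·)/(2τ)`, then
for nearby `y` a discrete evolution variational inequality holds: `(1 + λτ) d²(z,y) ≤ d²(x,y) + 2τ
(f y - f z) + K d²(x,z)` (`LocalEVI`). It comes from the first-order condition for `z` along the
geodesic to `y` (`IsProx.first_order`), combined with the bound `d²(x,y) - d²(z,y) + K d²(x,z)` for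
the initial slope of `d²(x,·)` along that geodesic. With commuting squared distances, the slope may
be computed along the geodesic from `z` to `x` instead, where semi-convexity bounds it. In a
`CAT(1)`-space, spherical comparison gives it with `K = 0` at distances below `1`.

The error `K d²(x,z)` is at most `2Kτ` times the energy drop of the step. Drops telescope, so all
errors together are of the order of the mesh. Two discrete solutions with unrelated partitions are
compared by doubling the time variables: the inequality is tested for each solution against the
current point of the other, each result is divided by its own step, and in the sum the values of `f`
cancel. A discrete maximum principle (`LocalEVI.exp_sq_dist_le`) then bounds the weighted squared
distance by an explicit function of both times. The inequality is only local, so the induction also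
carries closeness of the two solutions; this needs close starting points
(`LocalEVI.eventually_exp_sq_dist_le`).

With equal starting points the estimate makes discrete solutions Cauchy as the mesh vanishes, giving
existence and uniqueness. For close starting points it passes to the limit as a contraction. Distant
starting points are joined by a geodesic inside the domain, which is cut into short pieces whose
contraction estimates add up. -/

namespace MetricFlow

/-! ### Discrete solutions for a real-valued function on a set -/

/-- `z` minimizes `f + d²(x, ·) / (2τ)` over `S`. -/
def IsProx {X : Type*} [MetricSpace X] (S : Set X) (f : X → ℝ) (τ : ℝ) (x z : X) : Prop :=
  z ∈ S ∧ ∀ w ∈ S, f z + dist x z ^ 2 / (2 * τ) ≤ f w + dist x w ^ 2 / (2 * τ)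

/-- The first `n` steps of a discrete solution at times `t` with step sizes at most `ε`. -/
structure IsScheme {X : Type*} [MetricSpace X] (S : Set X) (f : X → ℝ) (ε : ℝ) (n : ℕ)
    (t : ℕ → ℝ) (x : ℕ → X) : Prop where
  time_zero : t 0 = 0
  mem_zero : x 0 ∈ S
  lt_succ : ∀ k < n, t k < t (k + 1)
  succ_le : ∀ k < n, t (k + 1) ≤ t k + ε
  prox : ∀ k < n, IsProx S f (t (k + 1) - t k) (x k) (x (k + 1))

section Scheme

variable {X : Type*} [MetricSpace X] {S : Set X} {f : X → ℝ} {ε : ℝ} {n : ℕ} {t : ℕ → ℝ}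
  {x : ℕ → X}

lemma IsProx.sq_dist_le {τ : ℝ} (hτ : 0 < τ) {x z : X} (hx : x ∈ S) (h : IsProx S f τ x z) :
    dist x z ^ 2 ≤ 2 * τ * (f x - f z) := by
  have h1 := h.2 x hx
  simp only [dist_self] at h1
  have h2 : dist x z ^ 2 / (2 * τ) ≤ f x - f z := by
    have : (0 : ℝ) ^ 2 / (2 * τ) = 0 := by simp
    linarith
  rw [div_le_iff₀ (by positivity)] at h2
  linarith

lemma IsScheme.mono_mesh (h : IsScheme S f ε n t x) {ε' : ℝ} (hε : ε ≤ ε') :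
    IsScheme S f ε' n t x :=
  ⟨h.time_zero, h.mem_zero, h.lt_succ, fun k hk => (h.succ_le k hk).trans (by linarith), h.prox⟩

lemma IsScheme.mem (h : IsScheme S f ε n t x) : ∀ k ≤ n, x k ∈ S
  | 0, _ => h.mem_zero
  | k + 1, hk => (h.prox k hk).1

lemma IsScheme.time_mono (h : IsScheme S f ε n t x) {j k : ℕ} (hjk : j ≤ k) (hk : k ≤ n) :
    t j ≤ t k := by
  induction k, hjk using Nat.le_induction with
  | base => exact le_rfl
  | succ k hjk ih => exact (ih (by omega)).trans (h.lt_succ k hk).le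

lemma IsScheme.time_nonneg (h : IsScheme S f ε n t x) {k : ℕ} (hk : k ≤ n) : 0 ≤ t k := by
  have := h.time_mono (Nat.zero_le k) hk
  rwa [h.time_zero] at this

/-- The one-step estimates add up by a discrete Cauchy–Schwarz inequality: from `p² ≤ 2au` and `q² ≤
2bv` follows `pq ≤ av + bu`, hence `(p + q)² ≤ 2(a + b)(u + v)`. With bounded energy drop this is
Hölder continuity of exponent `1/2` in time. -/
lemma IsScheme.energy_dist (h : IsScheme S f ε n t x) {j k : ℕ} (hjk : j ≤ k) (hk : k ≤ n) :
    f (x k) ≤ f (x j) ∧ dist (x j) (x k) ^ 2 ≤ 2 * (t k - t j) * (f (x j) - f (x k)) := by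
  induction k, hjk using Nat.le_induction with
  | base => simp
  | succ k hjk ih =>
    obtain ⟨ih1, ih2⟩ := ih (by omega)
    have hτ : 0 < t (k + 1) - t k := by linarith [h.lt_succ k hk]
    have h2 := (h.prox k hk).sq_dist_le hτ (h.mem k (by omega))
    have ht := h.time_mono hjk (by omega : k ≤ n)
    have h1 : f (x (k + 1)) ≤ f (x k) := by
      by_contra hc
      push Not at hc
      nlinarith [sq_nonneg (dist (x k) (x (k + 1)))]
    refine ⟨h1.trans ih1, ?_⟩
    have htri := dist_triangle (x j) (x k) (x (k + 1))
    set p := dist (x j) (x k)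
    set q := dist (x k) (x (k + 1))
    have hp : 0 ≤ p := dist_nonneg
    have hq : 0 ≤ q := dist_nonneg
    set a := t k - t j with ha
    set b := t (k + 1) - t k with hb
    set u := f (x j) - f (x k) with hu
    set v := f (x k) - f (x (k + 1)) with hv
    have ha0 : 0 ≤ a := by linarith
    have hu0 : 0 ≤ u := by linarith
    have hv0 : 0 ≤ v := by linarith
    have hcross : 2 * (p * q) ≤ 2 * (a * v) + 2 * (b * u) := by
      have h3 : (p * q) ^ 2 ≤ (a * v + b * u) ^ 2 := by
        have h4 : p ^ 2 * q ^ 2 ≤ (2 * a * u) * (2 * b * v) :=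
          mul_le_mul ih2 h2 (sq_nonneg _) (by positivity)
        nlinarith [sq_nonneg (a * v - b * u)]
      have := abs_le_of_sq_le_sq h3 (by positivity)
      linarith [le_abs_self (p * q)]
    have h5 : dist (x j) (x (k + 1)) ^ 2 ≤ (p + q) ^ 2 :=
      pow_le_pow_left₀ dist_nonneg htri 2
    have e1 : t (k + 1) - t j = a + b := by ring
    have e2 : f (x j) - f (x (k + 1)) = u + v := by ring
    rw [e1, e2]
    nlinarith

lemma IsScheme.exists_index (h : IsScheme S f ε n t x) {k : ℕ} (hk : k ≤ n) (hk0 : 0 < k)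
    {s : ℝ} (hs0 : 0 ≤ s) (hs : s ≤ t k) : ∃ j < k, t j ≤ s ∧ s ≤ t j + ε := by
  induction k with
  | zero => omega
  | succ k ih =>
    rcases le_or_gt (t k) s with h1 | h1
    · exact ⟨k, by omega, h1, hs.trans (h.succ_le k hk)⟩
    · have : 0 < k := by
        rcases Nat.eq_zero_or_pos k with rfl | h2
        · rw [h.time_zero] at h1; linarith
        · exact h2
      obtain ⟨j, hj, hj'⟩ := ih (by omega) this h1.le
      exact ⟨j, by omega, hj'⟩

/-- Discrete solutions from a given point stay bounded on bounded time intervals. -/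
lemma exists_dist_bound {C A : ℝ} (hC : 0 < C) {x₀ : X}
    (hgr : ∀ y ∈ S, -A - C * dist x₀ y ^ 2 ≤ f y) (N : ℕ) :
    ∃ R, 0 ≤ R ∧ ∀ (n : ℕ) (t : ℕ → ℝ) (x : ℕ → X), IsScheme S f (1 / (16 * C)) n t x → x 0 = x₀ →
      ∀ k ≤ n, t k ≤ N * (1 / (16 * C)) → dist x₀ (x k) ≤ R := by
  induction N with
  | zero =>
    refine ⟨0, le_rfl, fun n t x h h0 k hk htk => ?_⟩
    have ht : t k = 0 := le_antisymm (by simpa using htk) (h.time_nonneg hk)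
    have := (h.energy_dist (Nat.zero_le k) hk).2
    rw [ht, h.time_zero, h0] at this
    have h1 : dist x₀ (x k) ^ 2 ≤ 0 := by linarith
    nlinarith [dist_nonneg (x := x₀) (y := x k)]
  | succ N ih =>
    obtain ⟨R, hR0, hR⟩ := ih
    set η := 1 / (16 * C) with hη
    have hη0 : 0 < η := by positivity
    -- An index `j` with `t j ≤ Nη` lies at most `2η` before `t k`, so the squared step `q²` from `x
    -- j` to `x k` is at most `4η` times the energy drop. Quadratic growth bounds the drop up to a
    -- term `2C q²`. As `8ηC = 1/2`, that term is absorbed, which turns `4η` into `8η`.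
    refine ⟨R + √(8 * η * (|f x₀| + |A| + 2 * C * R ^ 2)), by positivity,
      fun n t x h h0 k hk htk => ?_⟩
    rcases le_or_gt (t k) (N * η) with h1 | h1
    · exact (hR n t x h h0 k hk h1).trans (le_add_of_nonneg_right (Real.sqrt_nonneg _))
    · have hk0 : 0 < k := by
        rcases Nat.eq_zero_or_pos k with rfl | h2
        · rw [h.time_zero] at h1
          have : 0 ≤ N * η := by positivity
          linarith
        · exact h2
      obtain ⟨j, hj, hj1, hj2⟩ := h.exists_index hk hk0 (by positivity) h1.le
      have hd := hR n t x h h0 j (by omega) hj1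
      obtain ⟨he, hd2⟩ := h.energy_dist hj.le hk
      have he0 := (h.energy_dist (Nat.zero_le j) (by omega)).1
      rw [h0] at he0
      have hg := hgr (x k) (h.mem k hk)
      have htri := dist_triangle x₀ (x j) (x k)
      refine htri.trans (add_le_add hd (Real.le_sqrt_of_sq_le ?_))
      set p := dist x₀ (x j)
      set q := dist (x j) (x k)
      have hp : 0 ≤ p := dist_nonneg
      have hq : 0 ≤ q := dist_nonneg
      have h2 : dist x₀ (x k) ^ 2 ≤ 2 * R ^ 2 + 2 * q ^ 2 := by
        have : dist x₀ (x k) ^ 2 ≤ (R + q) ^ 2 :=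
          pow_le_pow_left₀ dist_nonneg (by linarith) 2
        nlinarith [sq_nonneg (R - q)]
      have h3 : t k - t j ≤ 2 * η := by
        push_cast at htk
        linarith
      have h4 : 0 ≤ f (x j) - f (x k) := by linarith
      have h5 : q ^ 2 ≤ 4 * η * (f (x j) - f (x k)) := by
        refine hd2.trans (mul_le_mul_of_nonneg_right (by linarith) h4)
      have h6 : f (x j) - f (x k) ≤ |f x₀| + |A| + C * (2 * R ^ 2 + 2 * q ^ 2) := by
        have := le_abs_self (f x₀)
        have := le_abs_self A
        have := mul_le_mul_of_nonneg_left h2 hC.le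
        linarith
      have h7 : η * C = 1 / 16 := by rw [hη]; field_simp
      have h8 : 4 * η * (f (x j) - f (x k)) ≤
          4 * η * (|f x₀| + |A| + C * (2 * R ^ 2 + 2 * q ^ 2)) :=
        mul_le_mul_of_nonneg_left h6 (by positivity)
      have h9 : 4 * η * (|f x₀| + |A| + C * (2 * R ^ 2 + 2 * q ^ 2)) =
          4 * η * (|f x₀| + |A| + 2 * C * R ^ 2) + 8 * (η * C) * q ^ 2 := by ring
      rw [h7] at h9
      linarith

/-- A priori bounds for discrete solutions from a given point on `[0, T]`. -/
lemma exists_apriori_bound {C A : ℝ} (hC : 0 < C) {x₀ : X}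
    (hgr : ∀ y ∈ S, -A - C * dist x₀ y ^ 2 ≤ f y) (T : ℝ) :
    ∃ M, 0 < M ∧ ∀ (n : ℕ) (t : ℕ → ℝ) (x : ℕ → X), IsScheme S f (1 / (16 * C)) n t x → x 0 = x₀ →
      ∀ k ≤ n, t k ≤ T → dist x₀ (x k) ≤ M ∧ f x₀ - f (x k) ≤ M := by
  obtain ⟨N, hN⟩ := exists_nat_ge (T * (16 * C))
  obtain ⟨R, hR0, hR⟩ := exists_dist_bound hC hgr N
  refine ⟨R + |f x₀| + |A| + C * R ^ 2 + 1, by positivity, fun n t x h h0 k hk htk => ?_⟩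
  have hd := hR n t x h h0 k hk (by
    rw [mul_one_div, le_div_iff₀ (by positivity)]
    exact (mul_le_mul_of_nonneg_right htk (by positivity)).trans hN)
  have hg := hgr (x k) (h.mem k hk)
  have h2 : C * dist x₀ (x k) ^ 2 ≤ C * R ^ 2 :=
    mul_le_mul_of_nonneg_left (pow_le_pow_left₀ dist_nonneg hd 2) hC.le
  have := le_abs_self (f x₀)
  have := le_abs_self A
  have := abs_nonneg (f x₀)
  have := abs_nonneg A
  have : 0 ≤ C * R ^ 2 := by positivity
  exact ⟨by linarith, by linarith⟩

end Scheme

/-! ### Comparison of two discrete solutions -/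

/-- The discrete evolution variational inequality at mutual distances below `r`, with a quadratic
error term. -/
def LocalEVI {X : Type*} [MetricSpace X] (S : Set X) (f : X → ℝ) (lam r K : ℝ) : Prop :=
  ∀ τ : ℝ, 0 < τ → ∀ x ∈ S, ∀ z, IsProx S f τ x z → ∀ y ∈ S,
    dist x z < r → dist x y < r → dist z y < r →
      (1 + lam * τ) * dist z y ^ 2 ≤
        dist x y ^ 2 + 2 * τ * (f y - f z) + K * dist x z ^ 2

/-- Replaces the factors `1 + λτ` by exponentials, whose products depend only on elapsed time, for
either sign of `λ`. The loss in the rate is `2λ²ε` and vanishes with the mesh. The proof is `exp v ≤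
1 + v + v²` at `v = u - 2u²`, where `v² ≤ 2u²`. -/
lemma exp_sub_two_sq_le {u : ℝ} (hu : |u| ≤ 1 / 5) : Real.exp (u - 2 * u ^ 2) ≤ 1 + u := by
  obtain ⟨h1, h2⟩ := abs_le.1 hu
  have hv : |u - 2 * u ^ 2| ≤ 1 := abs_le.2 ⟨by nlinarith, by nlinarith⟩
  have h3 := (abs_le.1 (Real.abs_exp_sub_one_sub_id_le hv)).2
  have h4 : (u - 2 * u ^ 2) ^ 2 ≤ 2 * u ^ 2 := by
    have : (1 - 2 * u) ^ 2 ≤ 2 := by nlinarith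
    nlinarith [mul_le_mul_of_nonneg_left this (sq_nonneg u)]
  linarith

section Comparison

variable {X : Type*} [MetricSpace X] {S : Set X} {f : X → ℝ} {ε : ℝ} {n m : ℕ} {t s : ℕ → ℝ}
  {x y : ℕ → X}

lemma IsScheme.sq_dist_le (h : IsScheme S f ε n t x) {M : ℝ}
    (hM : ∀ k ≤ n, f (x 0) - f (x k) ≤ M) {j k : ℕ} (hjk : j ≤ k) (hk : k ≤ n) :
    dist (x j) (x k) ^ 2 ≤ 2 * M * (t k - t j) := by
  obtain ⟨_, h2⟩ := h.energy_dist hjk hk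
  have h3 := (h.energy_dist (Nat.zero_le j) (hjk.trans hk)).1
  have h4 := hM k hk
  have h5 := h.time_mono hjk hk
  nlinarith

/-- Spreads closeness from pairs of almost equal times to pairs of times differing by at most `ρ`:
by Hölder continuity the solution moves at most `r/4` within time `ρ + ε`. This makes the local
inequality available in a whole strip around the diagonal. -/
lemma IsScheme.dist_le_half (h : IsScheme S f ε n t x) {M ρ r : ℝ} (hM0 : 0 ≤ M) (hr : 0 < r)
    (hM : ∀ k ≤ n, f (x 0) - f (x k) ≤ M) (hr2 : 2 * M * (ρ + ε) ≤ (r / 4) ^ 2)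
    {k : ℕ} (hk : k ≤ n) (hk0 : 0 < k) {s : ℝ} (hs0 : 0 ≤ s) (hs : s ≤ t k) (hsρ : t k - s ≤ ρ)
    {p : X} (hp : ∀ j < k, |t j - s| ≤ ε → dist (x j) p ≤ r / 4) : dist (x k) p ≤ r / 2 := by
  obtain ⟨j, hj, hj1, hj2⟩ := h.exists_index hk hk0 hs0 hs
  have h1 := hp j hj (abs_le.2 ⟨by linarith, by linarith⟩)
  have h2 := h.sq_dist_le hM hj.le hk
  have h3 : dist (x j) (x k) ^ 2 ≤ (r / 4) ^ 2 := by
    refine (h2.trans ?_).trans hr2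
    exact mul_le_mul_of_nonneg_left (by linarith) (by positivity)
  have h4 := abs_le_of_sq_le_sq h3 (by positivity)
  rw [abs_of_nonneg dist_nonneg] at h4
  have := dist_triangle_left (x k) p (x j)
  linarith

/-- One step of the evolution variational inequality in exponential form. -/
lemma LocalEVI.exp_step {lam r K μ : ℝ} (hevi : LocalEVI S f lam r K) (hK : 0 ≤ K)
    (hμ : ∀ τ, 0 ≤ τ → τ ≤ ε → Real.exp (μ * τ) ≤ 1 + lam * τ)
    (hx : IsScheme S f ε n t x) {k : ℕ} (hk : k < n) {p : X} (hp : p ∈ S)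
    (h1 : dist (x k) (x (k + 1)) < r) (h2 : dist (x k) p < r) (h3 : dist (x (k + 1)) p < r) :
    Real.exp (μ * (t (k + 1) - t k)) * dist (x (k + 1)) p ^ 2 - dist (x k) p ^ 2 ≤
      2 * (t (k + 1) - t k) * (f p - f (x (k + 1)) + K * (f (x k) - f (x (k + 1)))) := by
  have hτ : 0 < t (k + 1) - t k := by linarith [hx.lt_succ k hk]
  have e1 := hevi _ hτ (x k) (hx.mem k hk.le) (x (k + 1)) (hx.prox k hk) p hp h1 h2 h3
  have e2 := mul_le_mul_of_nonneg_right (hμ _ hτ.le (by linarith [hx.succ_le k hk]))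
    (sq_nonneg (dist (x (k + 1)) p))
  have e3 := mul_le_mul_of_nonneg_left
    ((hx.prox k hk).sq_dist_le hτ (hx.mem k hk.le)) hK
  nlinarith

lemma exp_mem_half_two {u : ℝ} (hu : |u| ≤ 1 / 2) :
    1 / 2 ≤ Real.exp u ∧ |Real.exp u - 1| ≤ 2 * |u| := by
  have h := Real.abs_exp_sub_one_le (x := u) (by linarith)
  refine ⟨?_, h⟩
  have := Real.add_one_le_exp u
  linarith [(abs_le.1 hu).1]

/-- The comparison function is a supersolution. -/
lemma supersolution_step {p q τ σ w A L ε T b Q c d Fkl Fk Fl : ℝ}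
    (hτ : 0 < τ) (hσ : 0 < σ) (hτε : τ ≤ ε) (hσε : σ ≤ ε)
    (hp : 1 / 2 ≤ p) (hq : 1 / 2 ≤ q) (hpq : |p - q| ≤ 4 * b * ε) (hw : |w| ≤ T) (hA : 0 ≤ A)
    (hL : L = 1 + 8 * T * b) (hb : 0 ≤ b) (hQ : 0 ≤ Q) (hc : 0 ≤ c) (hd : 0 ≤ d)
    (hk : Fk ≤ 0) (hl : Fl ≤ 0)
    (hstep : p * (Fkl - Fk + A * (2 * w * τ - τ ^ 2 + L * ε * τ) + Q * ε * c) / τ +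
      q * (Fkl - Fl + A * (-(2 * w * σ) - σ ^ 2 + L * ε * σ) + Q * ε * d) / σ ≤
      Q / 2 * (c + d)) : Fkl ≤ 0 := by
  -- `Fkl`, `Fk`, `Fl` stand for the weighted squared distance minus the comparison function at a
  -- pair of indices and at its two predecessors. If `Fkl` were positive, both difference quotients
  -- would be positive, while the comparison function alone already accounts for the right side of
  -- `hstep`.
  by_contra hF
  push Not at hF
  have hε : 0 < ε := hτ.trans_le hτε
  have hT : 0 ≤ T := (abs_nonneg w).trans hw
  have e1 : p * (Fkl - Fk + A * (2 * w * τ - τ ^ 2 + L * ε * τ) + Q * ε * c) / τ =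
      p * (Fkl - Fk) / τ + p * A * (2 * w - τ + L * ε) + p * (Q * (ε / τ) * c) := by
    field_simp
  have e2 : q * (Fkl - Fl + A * (-(2 * w * σ) - σ ^ 2 + L * ε * σ) + Q * ε * d) / σ =
      q * (Fkl - Fl) / σ + q * A * (-(2 * w) - σ + L * ε) + q * (Q * (ε / σ) * d) := by
    field_simp
  have h1 : 0 < p * (Fkl - Fk) / τ := by
    have : 0 < p := by linarith
    have : 0 < Fkl - Fk := by linarith
    positivity
  have h2 : 0 < q * (Fkl - Fl) / σ := by
    have : 0 < q := by linarith
    have : 0 < Fkl - Fl := by linarith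
    positivity
  have h3 : Q / 2 * c ≤ p * (Q * (ε / τ) * c) := by
    have : 1 ≤ ε / τ := by rwa [le_div_iff₀ hτ, one_mul]
    have h4 : 1 / 2 * (Q * c * 1) ≤ p * (Q * c * (ε / τ)) := by gcongr
    linarith
  have h5 : Q / 2 * d ≤ q * (Q * (ε / σ) * d) := by
    have : 1 ≤ ε / σ := by rwa [le_div_iff₀ hσ, one_mul]
    have h4 : 1 / 2 * (Q * d * 1) ≤ q * (Q * d * (ε / σ)) := by gcongr
    linarith
  -- The terms `±2w` cancel up to `2(p - q)w ≥ -8bεT`; the summand `8Tb` of `L` pays for this, and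
  -- the summand `1` for `τ` and `σ`.
  have h6 : 0 ≤ p * (2 * w - τ + L * ε) + q * (-(2 * w) - σ + L * ε) := by
    have h7 : |(p - q) * w| ≤ 4 * b * ε * T := by
      rw [abs_mul]; gcongr
    have h8 := (abs_le.1 h7).1
    have h9 : 8 * T * b * ε ≤ p * (L * ε - τ) + q * (L * ε - σ) := by
      have h10 : 8 * T * b * ε ≤ L * ε - τ := by rw [hL]; linarith
      have h11 : 8 * T * b * ε ≤ L * ε - σ := by rw [hL]; linarith
      have h12 : 0 ≤ 8 * T * b * ε := by positivity
      have h13 : 1 / 2 * (8 * T * b * ε) ≤ p * (L * ε - τ) := by gcongr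
      have h14 : 1 / 2 * (8 * T * b * ε) ≤ q * (L * ε - σ) := by gcongr
      linarith
    linarith
  have h15 := mul_nonneg hA h6
  rw [e1, e2] at hstep
  linarith

/-- Doubling of variables: a bound on the mutual distances of two discrete solutions. -/
lemma LocalEVI.exp_sq_dist_le {lam r K μ T M R ρ D A L Q G b δ : ℝ}
    (hevi : LocalEVI S f lam r K) (hr : 0 < r) (hK : 0 ≤ K)
    (hμ : ∀ τ, 0 ≤ τ → τ ≤ ε → Real.exp (μ * τ) ≤ 1 + lam * τ) (hμb : |μ| ≤ b)
    (hε : 0 < ε) (hbε : b * ε ≤ 1 / 2)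
    (hx : IsScheme S f ε n t x) (hy : IsScheme S f ε m s y)
    (hTx : ∀ k ≤ n, t k ≤ T) (hTy : ∀ l ≤ m, s l ≤ T) (hM0 : 0 ≤ M)
    (hMx : ∀ k ≤ n, f (x 0) - f (x k) ≤ M) (hMy : ∀ l ≤ m, f (y 0) - f (y l) ≤ M)
    (hR : ∀ k ≤ n, ∀ l ≤ m, dist (x k) (y l) ≤ R)
    (hG : G = Real.exp (2 * b * T)) (hA : 0 ≤ A) (hAρ : G * R ^ 2 ≤ A * ρ ^ 2) (hρ : 0 < ρ)
    (hD : 0 ≤ D)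
    (hbx : ∀ k ≤ n, t k ≤ ρ → Real.exp (μ * t k) * dist (x k) (y 0) ^ 2 ≤ D)
    (hby : ∀ l ≤ m, s l ≤ ρ → Real.exp (μ * s l) * dist (x 0) (y l) ^ 2 ≤ D)
    (hL : L = 1 + 8 * T * b) (hQ : Q = 4 * K * G)
    (hsmall : A * (ε ^ 2 + L * ε * (2 * T)) + Q * ε * (2 * M) ≤ δ)
    (hr1 : G * (D + δ) ≤ (r / 4) ^ 2) (hr2 : 2 * M * (ρ + ε) ≤ (r / 4) ^ 2)
    {k l : ℕ} (hk : k ≤ n) (hl : l ≤ m) :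
    Real.exp (μ * (t k + s l)) * dist (x k) (y l) ^ 2 ≤
      D + A * ((t k - s l) ^ 2 + L * ε * (t k + s l)) +
        Q * ε * ((f (x 0) - f (x k)) + (f (y 0) - f (y l))) := by
  have hT0 : 0 ≤ T := by have := hTx 0 (Nat.zero_le _); rwa [hx.time_zero] at this
  have hb0 : 0 ≤ b := (abs_nonneg _).trans hμb
  have hG0 : 0 < G := hG ▸ Real.exp_pos _
  have hQ0 : 0 ≤ Q := by rw [hQ]; positivity
  have hL0 : 0 ≤ L := by rw [hL]; positivity
  have hexpG : ∀ k ≤ n, ∀ l ≤ m, Real.exp (μ * (t k + s l)) ≤ G ∧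
      1 ≤ G * Real.exp (μ * (t k + s l)) := by
    intro k hk l hl
    have h0 : 0 ≤ t k + s l := add_nonneg (hx.time_nonneg hk) (hy.time_nonneg hl)
    have h1 : |μ * (t k + s l)| ≤ 2 * b * T := by
      rw [abs_mul, abs_of_nonneg h0]
      calc |μ| * (t k + s l) ≤ b * (T + T) :=
            mul_le_mul hμb (add_le_add (hTx k hk) (hTy l hl)) h0 hb0
        _ = 2 * b * T := by ring
    rw [hG, ← Real.exp_add]
    refine ⟨Real.exp_le_exp.2 (abs_le.1 h1).2, ?_⟩
    rw [Real.one_le_exp_iff]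
    linarith [(abs_le.1 h1).1]
  have hfx : ∀ k ≤ n, 0 ≤ f (x 0) - f (x k) := fun k hk => by
    linarith [(hx.energy_dist (Nat.zero_le k) hk).1]
  have hfy : ∀ l ≤ m, 0 ≤ f (y 0) - f (y l) := fun l hl => by
    linarith [(hy.energy_dist (Nat.zero_le l) hl).1]
  -- The two inequalities at a pair use its two predecessors, and their locality conditions use
  -- near-diagonal pairs of smaller index sum; strong induction on the sum covers both.
  induction hN : k + l using Nat.strong_induction_on generalizing k l with
  | _ N ih =>
  have htk := hx.time_nonneg hk
  have hsl := hy.time_nonneg hl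
  have hLpos : 0 ≤ L * ε * (t k + s l) := by positivity
  have hQpos : 0 ≤ Q * ε * ((f (x 0) - f (x k)) + (f (y 0) - f (y l))) :=
    mul_nonneg (by positivity) (add_nonneg (hfx k hk) (hfy l hl))
  -- Outside the strip of width `ρ` the choice of `A` makes the bound follow from the crude a priori
  -- bound `R`.
  rcases le_or_gt ρ |t k - s l| with hfar | hnear
  · have h1 : ρ ^ 2 ≤ (t k - s l) ^ 2 := by
      rw [← sq_abs (t k - s l)]; exact pow_le_pow_left₀ hρ.le hfar 2
    have h2 : Real.exp (μ * (t k + s l)) * dist (x k) (y l) ^ 2 ≤ G * R ^ 2 :=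
      mul_le_mul (hexpG k hk l hl).1 (pow_le_pow_left₀ dist_nonneg (hR k hk l hl) 2)
        (sq_nonneg _) hG0.le
    have h3 : A * ρ ^ 2 ≤ A * ((t k - s l) ^ 2 + L * ε * (t k + s l)) :=
      mul_le_mul_of_nonneg_left (by linarith) hA
    linarith
  have hBpos : D ≤ D + A * ((t k - s l) ^ 2 + L * ε * (t k + s l)) +
      Q * ε * ((f (x 0) - f (x k)) + (f (y 0) - f (y l))) := by
    have : 0 ≤ A * ((t k - s l) ^ 2 + L * ε * (t k + s l)) := by positivity
    linarith
  rcases Nat.eq_zero_or_pos k with rfl | hk0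
  · refine le_trans ?_ hBpos
    rw [hx.time_zero, zero_add]
    refine hby l hl ?_
    rw [hx.time_zero, zero_sub, abs_neg] at hnear
    exact (le_abs_self _).trans hnear.le
  rcases Nat.eq_zero_or_pos l with rfl | hl0
  · refine le_trans ?_ hBpos
    rw [hy.time_zero, add_zero]
    refine hbx k hk ?_
    rw [hy.time_zero, sub_zero] at hnear
    exact (le_abs_self _).trans hnear.le
  -- Near the diagonal the comparison function is at most `D + δ`, so the induction hypothesis
  -- yields actual closeness.
  have hdiag : ∀ i ≤ n, ∀ j ≤ m, i + j < N → |t i - s j| ≤ ε → dist (x i) (y j) ≤ r / 4 := by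
    intro i hi j hj hij hts
    have h1 := ih (i + j) hij hi hj rfl
    have h2 : D + A * ((t i - s j) ^ 2 + L * ε * (t i + s j)) +
        Q * ε * ((f (x 0) - f (x i)) + (f (y 0) - f (y j))) ≤ D + δ := by
      have h3 : (t i - s j) ^ 2 ≤ ε ^ 2 := by
        rw [← sq_abs (t i - s j)]; exact pow_le_pow_left₀ (abs_nonneg _) hts 2
      have h4 : A * ((t i - s j) ^ 2 + L * ε * (t i + s j)) ≤ A * (ε ^ 2 + L * ε * (2 * T)) := by
        have := hTx i hi
        have := hTy j hj
        gcongr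
        linarith
      have h5 : Q * ε * ((f (x 0) - f (x i)) + (f (y 0) - f (y j))) ≤ Q * ε * (2 * M) := by
        have := hMx i hi
        have := hMy j hj
        gcongr
        linarith
      linarith
    have h6 : dist (x i) (y j) ^ 2 ≤ (r / 4) ^ 2 := by
      have h7 := mul_le_mul_of_nonneg_left (h1.trans h2) hG0.le
      have h8 := mul_le_mul_of_nonneg_right (hexpG i hi j hj).2 (sq_nonneg (dist (x i) (y j)))
      linarith
    have h9 := abs_le_of_sq_le_sq h6 (by positivity)
    rwa [abs_of_nonneg dist_nonneg] at h9
  have hkl : dist (x k) (y l) ≤ r / 2 := by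
    rcases le_total (s l) (t k) with h | h
    · rw [abs_of_nonneg (by linarith)] at hnear
      exact hx.dist_le_half hM0 hr hMx hr2 hk hk0 hsl h hnear.le
        fun j hj hjs => hdiag j (by omega) l hl (by omega) hjs
    · rw [abs_of_nonpos (by linarith)] at hnear
      rw [dist_comm]
      refine hy.dist_le_half hM0 hr hMy hr2 hl hl0 htk h (by linarith)
        fun j hj hjs => ?_
      rw [dist_comm]
      exact hdiag k hk j (by omega) (by omega) (by rwa [abs_sub_comm])
  obtain ⟨k, rfl⟩ : ∃ k', k = k' + 1 := ⟨k - 1, by omega⟩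
  obtain ⟨l, rfl⟩ : ∃ l', l = l' + 1 := ⟨l - 1, by omega⟩
  have hτ : 0 < t (k + 1) - t k := by linarith [hx.lt_succ k hk]
  have hσ : 0 < s (l + 1) - s l := by linarith [hy.lt_succ l hl]
  have hτε : t (k + 1) - t k ≤ ε := by linarith [hx.succ_le k hk]
  have hσε : s (l + 1) - s l ≤ ε := by linarith [hy.succ_le l hl]
  have hdx : dist (x k) (x (k + 1)) ≤ r / 4 := by
    have h1 := hx.sq_dist_le hMx (Nat.le_succ k) hk
    have h2 : dist (x k) (x (k + 1)) ^ 2 ≤ (r / 4) ^ 2 :=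
      (h1.trans (mul_le_mul_of_nonneg_left (by linarith) (by positivity))).trans hr2
    have h3 := abs_le_of_sq_le_sq h2 (by positivity)
    rwa [abs_of_nonneg dist_nonneg] at h3
  have hdy : dist (y l) (y (l + 1)) ≤ r / 4 := by
    have h1 := hy.sq_dist_le hMy (Nat.le_succ l) hl
    have h2 : dist (y l) (y (l + 1)) ^ 2 ≤ (r / 4) ^ 2 :=
      (h1.trans (mul_le_mul_of_nonneg_left (by linarith) (by positivity))).trans hr2
    have h3 := abs_le_of_sq_le_sq h2 (by positivity)
    rwa [abs_of_nonneg dist_nonneg] at h3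
  have hd1 : dist (x k) (y (l + 1)) < r := by
    have := dist_triangle (x k) (x (k + 1)) (y (l + 1))
    linarith
  have hd2 : dist (y l) (x (k + 1)) < r := by
    have := dist_triangle (y l) (y (l + 1)) (x (k + 1))
    rw [dist_comm (y (l + 1))] at this
    linarith
  have s1 := hevi.exp_step hK hμ hx hk (hy.mem (l + 1) hl) (by linarith) hd1 (by linarith)
  have s2 := hevi.exp_step hK hμ hy hl (hx.mem (k + 1) hk) (by linarith) hd2
    (by rw [dist_comm]; linarith)
  rw [dist_comm (y (l + 1)), dist_comm (y l)] at s2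
  have ih1 := ih (k + (l + 1)) (by omega) (Nat.le_of_succ_le hk) hl rfl
  have ih2 := ih (k + 1 + l) (by omega) hk (Nat.le_of_succ_le hl) rfl
  have hw : |t (k + 1) - s (l + 1)| ≤ T := by
    have := hTx _ hk
    have := hTy _ hl
    exact abs_le.2 ⟨by linarith, by linarith⟩
  have hμτ : |μ * (t (k + 1) - t k)| ≤ b * ε := by
    rw [abs_mul, abs_of_pos hτ]; gcongr
  have hμσ : |μ * (s (l + 1) - s l)| ≤ b * ε := by
    rw [abs_mul, abs_of_pos hσ]; gcongr
  obtain ⟨hp1, hp2⟩ := exp_mem_half_two (hμτ.trans hbε)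
  obtain ⟨hq1, hq2⟩ := exp_mem_half_two (hμσ.trans hbε)
  have hfk : 0 ≤ f (x k) - f (x (k + 1)) := by
    linarith [(hx.energy_dist (Nat.le_succ k) hk).1]
  have hfl : 0 ≤ f (y l) - f (y (l + 1)) := by
    linarith [(hy.energy_dist (Nat.le_succ l) hl).1]
  have hW := (hexpG (k + 1) hk (l + 1) hl).1
  have hW0 := Real.exp_pos (μ * (t (k + 1) + s (l + 1)))
  have eW1 : Real.exp (μ * (t (k + 1) + s (l + 1))) =
      Real.exp (μ * (t (k + 1) - t k)) * Real.exp (μ * (t k + s (l + 1))) := by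
    rw [← Real.exp_add]; congr 1; ring
  have eW2 : Real.exp (μ * (t (k + 1) + s (l + 1))) =
      Real.exp (μ * (s (l + 1) - s l)) * Real.exp (μ * (t (k + 1) + s l)) := by
    rw [← Real.exp_add]; congr 1; ring
  set p := Real.exp (μ * (t (k + 1) - t k)) with hp
  set q := Real.exp (μ * (s (l + 1) - s l)) with hq
  set W := Real.exp (μ * (t (k + 1) + s (l + 1))) with hWdef
  have hpq : |p - q| ≤ 4 * b * ε := by
    have := abs_sub_le p 1 q
    rw [abs_sub_comm 1 q] at this
    linarith
  rw [← sub_nonpos]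
  refine supersolution_step (w := t (k + 1) - s (l + 1)) hτ hσ hτε hσε hp1 hq1 hpq hw hA hL hb0 hQ0
    hfk hfl (sub_nonpos.2 ih1) (sub_nonpos.2 ih2) ?_
  set τ := t (k + 1) - t k with hτdef
  set σ := s (l + 1) - s l with hσdef
  set D₁₁ := dist (x (k + 1)) (y (l + 1)) ^ 2
  set D₀₁ := dist (x k) (y (l + 1)) ^ 2
  set D₁₀ := dist (x (k + 1)) (y l) ^ 2
  set W₁ := Real.exp (μ * (t k + s (l + 1)))
  set W₂ := Real.exp (μ * (t (k + 1) + s l))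
  -- Dividing by the own step size leaves `f (y (l + 1)) - f (x (k + 1))` with a factor independent
  -- of the step; `g2` has the opposite difference with the same factor `2W`, so the sum keeps only
  -- the energy drops.
  have g1 : p * (W * D₁₁ - W₁ * D₀₁) / τ ≤
      W * (2 * (f (y (l + 1)) - f (x (k + 1)) + K * (f (x k) - f (x (k + 1))))) := by
    rw [div_le_iff₀ hτ]
    have := mul_le_mul_of_nonneg_left s1 hW0.le
    have e : p * (W * D₁₁ - W₁ * D₀₁) = W * (p * D₁₁ - D₀₁) := by rw [eW1]; ring
    rw [e]; linarith
  have g2 : q * (W * D₁₁ - W₂ * D₁₀) / σ ≤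
      W * (2 * (f (x (k + 1)) - f (y (l + 1)) + K * (f (y l) - f (y (l + 1))))) := by
    rw [div_le_iff₀ hσ]
    have := mul_le_mul_of_nonneg_left s2 hW0.le
    have e : q * (W * D₁₁ - W₂ * D₁₀) = W * (q * D₁₁ - D₁₀) := by rw [eW2]; ring
    rw [e]; linarith
  have g3 : W * (2 * K * ((f (x k) - f (x (k + 1))) + (f (y l) - f (y (l + 1))))) ≤
      Q / 2 * ((f (x k) - f (x (k + 1))) + (f (y l) - f (y (l + 1)))) := by
    have : W * (2 * K * ((f (x k) - f (x (k + 1))) + (f (y l) - f (y (l + 1))))) ≤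
        G * (2 * K * ((f (x k) - f (x (k + 1))) + (f (y l) - f (y (l + 1))))) := by
      gcongr
    rw [hQ]; linarith
  refine le_trans (le_of_eq ?_) ((add_le_add g1 g2).trans ?_)
  · congr 3
    · rw [hτdef]; ring
    · rw [hσdef]; ring
  · linarith

/-- `f` is bounded below by a quadratic function of the distance to any point of `S`, with a
common leading coefficient. -/
def QuadraticGrowth {X : Type*} [MetricSpace X] (S : Set X) (f : X → ℝ) (C : ℝ) : Prop :=
  ∀ x₀ ∈ S, ∃ A : ℝ, ∀ y ∈ S, -A - C * dist x₀ y ^ 2 ≤ f y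

/-- Supplies the boundary values of the comparison, where one solution is still at its starting
point: up to time `ρ` the other has moved at most `√(2Mρ)`. -/
lemma IsScheme.exp_mul_sq_dist_le (h : IsScheme S f ε n t x) {M ρ b μ D d : ℝ} {p : X}
    (hM0 : 0 ≤ M) (hM : ∀ k ≤ n, f (x 0) - f (x k) ≤ M) (hμb : |μ| ≤ b) (hd : dist (x 0) p ≤ d)
    (hD : Real.exp (b * ρ) * (d + √(2 * M * ρ)) ^ 2 ≤ D) {k : ℕ} (hk : k ≤ n) (hkρ : t k ≤ ρ) :
    Real.exp (μ * t k) * dist (x k) p ^ 2 ≤ D := by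
  refine le_trans ?_ hD
  have h0 := h.time_nonneg hk
  have h1 := h.sq_dist_le hM (Nat.zero_le k) hk
  rw [h.time_zero, sub_zero] at h1
  have h2 : dist (x 0) (x k) ≤ √(2 * M * ρ) := Real.le_sqrt_of_sq_le
    (h1.trans (mul_le_mul_of_nonneg_left hkρ (by positivity)))
  have h3 : dist (x k) p ≤ d + √(2 * M * ρ) := by
    have := dist_triangle_left (x k) p (x 0)
    linarith
  have h4 : μ * t k ≤ b * ρ :=
    mul_le_mul ((le_abs_self μ).trans hμb) hkρ h0 ((abs_nonneg μ).trans hμb)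
  exact mul_le_mul (Real.exp_le_exp.2 h4) (pow_le_pow_left₀ dist_nonneg h3 2) (sq_nonneg _)
    (Real.exp_pos _).le

/-- Two discrete solutions with nearby starting points and small step sizes satisfy an approximate
contraction estimate on `[0, T]`. -/
theorem LocalEVI.eventually_exp_sq_dist_le {lam r K C T : ℝ} (hevi : LocalEVI S f lam r K)
    (hr : 0 < r) (hK : 0 ≤ K) (hC : 0 < C) (hgr : QuadraticGrowth S f C) {x₀ y₀ : X}
    (hx₀ : x₀ ∈ S) (hy₀ : y₀ ∈ S) (hT : 0 ≤ T)
    (hd : Real.exp (2 * (2 * |lam| + 1) * T) * dist x₀ y₀ ^ 2 < (r / 4) ^ 2) {δ : ℝ} (hδ : 0 < δ) :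
    ∀ᶠ ε : ℝ in 𝓝[>] 0, ∀ (n m : ℕ) (t s : ℕ → ℝ) (x y : ℕ → X), IsScheme S f ε n t x →
      IsScheme S f ε m s y → x 0 = x₀ → y 0 = y₀ → t n ≤ T → s m ≤ T → |t n - s m| ≤ ε →
      Real.exp ((lam - 2 * lam ^ 2 * ε) * (t n + s m)) * dist (x n) (y m) ^ 2 ≤
        dist x₀ y₀ ^ 2 + δ := by
  set b := 2 * |lam| + 1 with hb
  have hb0 : 0 < b := by positivity
  set G := Real.exp (2 * b * T) with hG
  have hG0 : 0 < G := Real.exp_pos _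
  obtain ⟨Ax, hAx⟩ := hgr x₀ hx₀
  obtain ⟨Ay, hAy⟩ := hgr y₀ hy₀
  obtain ⟨Mx, hMx0, hMx⟩ := exists_apriori_bound hC hAx T
  obtain ⟨My, hMy0, hMy⟩ := exists_apriori_bound hC hAy T
  set M := max Mx My with hM
  have hM0 : 0 < M := lt_max_of_lt_left hMx0
  set d := dist x₀ y₀ with hddef
  have hd0 : 0 ≤ d := dist_nonneg
  set R := 2 * M + d with hR
  -- Constants are fixed in the order `η`, `ρ`, `A`, `ε`. One `η` is spent on the boundary values
  -- (through `ρ`), the other on the mesh error (through `ε`, once `A` is known); the assumed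
  -- smallness of `d` leaves room for both.
  obtain ⟨η, hη0, hηδ, hη⟩ : ∃ η, 0 < η ∧ 2 * η ≤ δ ∧ G * (d ^ 2 + η + η) ≤ (r / 4) ^ 2 := by
    refine ⟨min (δ / 2) (((r / 4) ^ 2 - G * d ^ 2) / (2 * G)), ?_, ?_, ?_⟩
    · exact lt_min (by positivity) (div_pos (by linarith) (by positivity))
    · linarith [min_le_left (δ / 2) (((r / 4) ^ 2 - G * d ^ 2) / (2 * G))]
    · have := min_le_right (δ / 2) (((r / 4) ^ 2 - G * d ^ 2) / (2 * G))
      rw [le_div_iff₀ (by positivity)] at this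
      linarith
  obtain ⟨ρ, hρ1, hρ2, hρ0⟩ : ∃ ρ, Real.exp (b * ρ) * (d + √(2 * M * ρ)) ^ 2 ≤ d ^ 2 + η ∧
      2 * M * (ρ + ρ) ≤ (r / 4) ^ 2 ∧ 0 < ρ := by
    have c1 : Tendsto (fun ρ : ℝ => Real.exp (b * ρ) * (d + √(2 * M * ρ)) ^ 2) (𝓝[>] 0)
        (𝓝 (d ^ 2)) := by
      have : Continuous fun ρ : ℝ => Real.exp (b * ρ) * (d + √(2 * M * ρ)) ^ 2 := by fun_prop
      simpa using (this.tendsto 0).mono_left (nhdsWithin_le_nhds (s := Set.Ioi (0 : ℝ)))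
    have c2 : Tendsto (fun ρ : ℝ => 2 * M * (ρ + ρ)) (𝓝[>] 0) (𝓝 0) := by
      have : Continuous fun ρ : ℝ => 2 * M * (ρ + ρ) := by fun_prop
      simpa using (this.tendsto 0).mono_left (nhdsWithin_le_nhds (s := Set.Ioi (0 : ℝ)))
    have e1 := c1.eventually_le_const (show d ^ 2 < d ^ 2 + η by linarith)
    have e2 := c2.eventually_le_const (show 0 < (r / 4) ^ 2 by positivity)
    exact (e1.and (e2.and self_mem_nhdsWithin)).exists
  set A := G * R ^ 2 / ρ ^ 2 with hA
  set L := 1 + 8 * T * b with hL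
  set Q := 4 * K * G with hQ
  have c3 : Tendsto (fun ε : ℝ => A * (ε ^ 2 + L * ε * (2 * T)) + Q * ε * (2 * M)) (𝓝[>] 0)
      (𝓝 0) := by
    have : Continuous fun ε : ℝ => A * (ε ^ 2 + L * ε * (2 * T)) + Q * ε * (2 * M) := by fun_prop
    simpa using (this.tendsto 0).mono_left (nhdsWithin_le_nhds (s := Set.Ioi (0 : ℝ)))
  have c4 : Tendsto (fun ε : ℝ => b * ε) (𝓝[>] 0) (𝓝 0) := by
    have : Continuous fun ε : ℝ => b * ε := by fun_prop
    simpa using (this.tendsto 0).mono_left (nhdsWithin_le_nhds (s := Set.Ioi (0 : ℝ)))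
  have c5 : Tendsto (fun ε : ℝ => ε) (𝓝[>] 0) (𝓝 0) := nhdsWithin_le_nhds
  filter_upwards [self_mem_nhdsWithin, c3.eventually_le_const hη0,
    c4.eventually_le_const (show (0 : ℝ) < 1 / 5 by norm_num), c5.eventually_le_const hρ0,
    c5.eventually_le_const (show 0 < 1 / (16 * C) by positivity)]
    with ε hε0 hsmall hbε hερ hεC n m t s x y hx hy hx0 hy0 htn hsm hts
  have hε0 : 0 < ε := hε0
  have hlε : |lam| * ε ≤ 1 / 5 := by
    refine le_trans (mul_le_mul_of_nonneg_right ?_ hε0.le) hbε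
    linarith [abs_nonneg lam]
  have hl2 : 2 * lam ^ 2 * ε ≤ 2 / 5 * |lam| := by
    rw [← sq_abs]
    nlinarith [abs_nonneg lam]
  have hl3 : 0 ≤ 2 * lam ^ 2 * ε := by positivity
  have hμb : |lam - 2 * lam ^ 2 * ε| ≤ b := by
    rw [abs_le]
    constructor <;> linarith [neg_abs_le lam, le_abs_self lam, abs_nonneg lam]
  have hμ : ∀ τ, 0 ≤ τ → τ ≤ ε → Real.exp ((lam - 2 * lam ^ 2 * ε) * τ) ≤ 1 + lam * τ := by
    intro τ hτ0 hτ
    refine le_trans (Real.exp_le_exp.2 ?_) (exp_sub_two_sq_le (u := lam * τ) ?_)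
    · have : lam ^ 2 * τ * τ ≤ lam ^ 2 * τ * ε := by gcongr
      linarith
    · rw [abs_mul, abs_of_nonneg hτ0]
      exact (mul_le_mul_of_nonneg_left hτ (abs_nonneg _)).trans hlε
  have hTx : ∀ k ≤ n, t k ≤ T := fun k hk => (hx.time_mono hk le_rfl).trans htn
  have hTy : ∀ l ≤ m, s l ≤ T := fun l hl => (hy.time_mono hl le_rfl).trans hsm
  have bx := fun k hk => hMx n t x (hx.mono_mesh hεC) hx0 k hk (hTx k hk)
  have bdy := fun l hl => hMy m s y (hy.mono_mesh hεC) hy0 l hl (hTy l hl)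
  have hMx' : ∀ k ≤ n, f (x 0) - f (x k) ≤ M := fun k hk => by
    rw [hx0]; exact (bx k hk).2.trans (le_max_left _ _)
  have hMy' : ∀ l ≤ m, f (y 0) - f (y l) ≤ M := fun l hl => by
    rw [hy0]; exact (bdy l hl).2.trans (le_max_right _ _)
  have hR' : ∀ k ≤ n, ∀ l ≤ m, dist (x k) (y l) ≤ R := by
    intro k hk l hl
    have h1 := (bx k hk).1.trans (le_max_left Mx My)
    have h2 := (bdy l hl).1.trans (le_max_right Mx My)
    have h3 := dist_triangle4_left x₀ y₀ (x k) (y l)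
    linarith
  have key := hevi.exp_sq_dist_le (D := d ^ 2 + η) (A := A) (ρ := ρ) hr hK hμ hμb hε0
    (by linarith) hx hy hTx hTy hM0.le hMx' hMy' hR' hG (by positivity)
    (le_of_eq (by rw [hA]; field_simp)) hρ0 (by positivity)
    (fun k hk hkρ => hx.exp_mul_sq_dist_le hM0.le hMx' hμb (by rw [hx0, hy0]) hρ1 hk hkρ)
    (fun l hl hlρ => by
      rw [dist_comm]
      exact hy.exp_mul_sq_dist_le hM0.le hMy' hμb (by rw [hx0, hy0, dist_comm]) hρ1 hl hlρ)
    hL hQ hsmall hη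
    ((mul_le_mul_of_nonneg_left (by linarith) (by positivity)).trans hρ2) (le_refl n) (le_refl m)
  refine key.trans ?_
  have h3 : (t n - s m) ^ 2 ≤ ε ^ 2 := by
    rw [← sq_abs (t n - s m)]; exact pow_le_pow_left₀ (abs_nonneg _) hts 2
  have h4 : A * ((t n - s m) ^ 2 + L * ε * (t n + s m)) ≤ A * (ε ^ 2 + L * ε * (2 * T)) := by
    gcongr
    linarith
  have h5 : Q * ε * ((f (x 0) - f (x n)) + (f (y 0) - f (y m))) ≤ Q * ε * (2 * M) := by
    have := hMx' n le_rfl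
    have := hMy' m le_rfl
    gcongr
    linarith
  linarith

end Comparison

/-! ### From minimizers in `EReal` to real-valued schemes -/

lemma coe_toReal_of_mem_dom {X : Type*} {φ : X → EReal} (hbot : ∀ x, φ x ≠ ⊥) {x : X} (hx : x ∈ dom φ) :
    ((φ x).toReal : EReal) = φ x :=
  EReal.coe_toReal hx (hbot x)

section Conversion

variable {X : Type*} [MetricSpace X] {φ : X → EReal}

lemma isProx_of_mem_minimizers (hbot : ∀ x, φ x ≠ ⊥) {τ : ℝ} {x z : X} (hx : x ∈ dom φ)
    (hz : z ∈ minimizers φ τ x) : IsProx (dom φ) (fun w => (φ w).toReal) τ x z := by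
  have h1 : ∀ w, φ z + ((dist x z ^ 2 / (2 * τ) : ℝ) : EReal) ≤
      φ w + ((dist x w ^ 2 / (2 * τ) : ℝ) : EReal) := by
    intro w
    have : φ z + ((dist x z ^ 2 / (2 * τ) : ℝ) : EReal) = moreauYosida φ τ x := hz
    rw [this]
    exact iInf_le _ w
  have hzd : z ∈ dom φ := by
    intro htop
    have h2 := h1 x
    rw [htop, EReal.top_add_coe, ← coe_toReal_of_mem_dom hbot hx, ← EReal.coe_add] at h2
    exact EReal.coe_ne_top _ (top_le_iff.1 h2)
  refine ⟨hzd, fun w hw => ?_⟩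
  have h2 := h1 w
  rw [← coe_toReal_of_mem_dom hbot hzd, ← coe_toReal_of_mem_dom hbot hw, ← EReal.coe_add,
    ← EReal.coe_add, EReal.coe_le_coe_iff] at h2
  exact h2

lemma IsProx.mem_minimizers (hbot : ∀ x, φ x ≠ ⊥) {τ : ℝ} {x z : X}
    (hz : IsProx (dom φ) (fun w => (φ w).toReal) τ x z) : z ∈ minimizers φ τ x := by
  refine le_antisymm (le_iInf fun w => ?_) (iInf_le _ z)
  by_cases hw : w ∈ dom φ
  · rw [← coe_toReal_of_mem_dom hbot hz.1, ← coe_toReal_of_mem_dom hbot hw, ← EReal.coe_add,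
      ← EReal.coe_add, EReal.coe_le_coe_iff]
    exact hz.2 w hw
  · have : φ w = ⊤ := not_not.1 hw
    rw [this, EReal.top_add_coe]
    exact le_top

lemma TimePartition.succ_le_of_mesh (P : TimePartition) {ε : ℝ} (hε : 0 ≤ ε)
    (h : P.mesh ≤ ENNReal.ofReal ε) (k : ℕ) : P.pt (k + 1) ≤ P.pt k + ε := by
  have h1 := (le_iSup (fun k : ℕ => ENNReal.ofReal (P.pt (k + 1) - P.pt k)) k).trans h
  rw [ENNReal.ofReal_le_ofReal_iff hε] at h1
  linarith

lemma TimePartition.mesh_le (P : TimePartition) {ε : ℝ}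
    (h : ∀ k, P.pt (k + 1) ≤ P.pt k + ε) : P.mesh ≤ ENNReal.ofReal ε :=
  iSup_le fun k => ENNReal.ofReal_le_ofReal (by linarith [h k])

lemma IsDiscreteSolution.isScheme (hbot : ∀ x, φ x ≠ ⊥) {P : TimePartition} {x₀ : X} {x : ℕ → X}
    (h : IsDiscreteSolution φ P x₀ x) (hx₀ : x₀ ∈ dom φ) {ε : ℝ} (hε : 0 ≤ ε)
    (hm : P.mesh ≤ ENNReal.ofReal ε) (n : ℕ) :
    IsScheme (dom φ) (fun w => (φ w).toReal) ε n P.pt x := by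
  have hmem : ∀ k, x k ∈ dom φ := by
    intro k
    induction k with
    | zero => rw [h.1]; exact hx₀
    | succ k ih => exact (isProx_of_mem_minimizers hbot ih (h.2 k)).1
  exact ⟨P.pt_zero, hmem 0, fun k _ => P.pt_strictMono (Nat.lt_succ_self k),
    fun k _ => P.succ_le_of_mesh hε hm k, fun k _ => isProx_of_mem_minimizers hbot (hmem k) (h.2 k)⟩

end Conversion

/-- The index used by the piecewise constant interpolation at time `t`. -/
lemma TimePartition.exists_interp_eq {X : Type*} (P : TimePartition) {ε : ℝ} (hε : 0 ≤ ε)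
    (hm : P.mesh ≤ ENNReal.ofReal ε) (t : ℝ≥0) :
    ∃ k : ℕ, (t : ℝ) ≤ P.pt k ∧ P.pt k ≤ t + ε ∧ ∀ x : ℕ → X, P.interp x t = x k := by
  have hne : {k : ℕ | (t : ℝ) ≤ P.pt k}.Nonempty :=
    (P.pt_tendsto.eventually_ge_atTop (t : ℝ)).exists
  refine ⟨sInf {k : ℕ | (t : ℝ) ≤ P.pt k}, Nat.sInf_mem hne, ?_, fun x => rfl⟩
  rcases Nat.eq_zero_or_pos (sInf {k : ℕ | (t : ℝ) ≤ P.pt k}) with h | h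
  · rw [h, P.pt_zero]
    positivity
  · obtain ⟨j, hj⟩ : ∃ j, sInf {k : ℕ | (t : ℝ) ≤ P.pt k} = j + 1 :=
      ⟨sInf {k : ℕ | (t : ℝ) ≤ P.pt k} - 1, by omega⟩
    have h1 : j ∉ {k : ℕ | (t : ℝ) ≤ P.pt k} := Nat.notMem_of_lt_sInf (by omega)
    have h2 : P.pt j < t := not_le.1 h1
    rw [hj]
    linarith [P.succ_le_of_mesh hε hm j]

/-! ### Existence of discrete solutions -/

/-- Minimizers exist for step sizes that are small uniformly on sublevel sets of `f` in balls. -/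
def HasProx {X : Type*} [MetricSpace X] (S : Set X) (f : X → ℝ) : Prop :=
  ∀ x₀ ∈ S, ∀ R M : ℝ, ∃ τ₀ > 0, ∀ x ∈ S, dist x₀ x ≤ R → f x ≤ M →
    ∀ τ, 0 < τ → τ < τ₀ → ∃ z, IsProx S f τ x z

/-- Allows the step size to depend on elapsed time. The times still diverge: below a bound `B` only
finitely many values of `g` occur, and their minimum is positive. -/
lemma exists_times (g : ℕ → ℝ) (hg : ∀ N, 0 < g N) :
    ∃ t : ℕ → ℝ, t 0 = 0 ∧ (∀ k, t (k + 1) = t k + g ⌊t k⌋₊) ∧ StrictMono t ∧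
      Tendsto t atTop atTop := by
  let t : ℕ → ℝ := fun k => Nat.rec 0 (fun _ a => a + g ⌊a⌋₊) k
  have hs : ∀ k, t (k + 1) = t k + g ⌊t k⌋₊ := fun k => rfl
  have hmono : StrictMono t := strictMono_nat_of_lt_succ fun k => by
    rw [hs]; linarith [hg ⌊t k⌋₊]
  refine ⟨t, rfl, hs, hmono, tendsto_atTop_atTop_of_monotone hmono.monotone fun B => ?_⟩
  by_contra! hB
  obtain ⟨j, -, hj⟩ := Finset.exists_min_image (Finset.range (⌊B⌋₊ + 1)) g ⟨0, by simp⟩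
  have h1 : ∀ k : ℕ, k * g j ≤ t k := by
    intro k
    induction k with
    | zero => simp [t]
    | succ k ih =>
      have h2 := hj ⌊t k⌋₊ (by
        rw [Finset.mem_range, Nat.lt_succ_iff]
        exact Nat.floor_mono (hB k).le)
      rw [hs]
      push_cast
      linarith
  obtain ⟨k, hk⟩ := exists_nat_gt (B / g j)
  rw [div_lt_iff₀ (hg j)] at hk
  linarith [h1 k, hB k]

/-- The admissible step size depends on the ball in which the solution lies. The a priori bound `M
N` on `[0, N + 1]` holds for every scheme of mesh at most `1 / (16C)`, so it is known before the
scheme is built and dictates the steps taken from times with integer part `N`. -/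
lemma HasProx.exists_scheme {X : Type*} [MetricSpace X] {S : Set X} {f : X → ℝ} {C : ℝ}
    (hprox : HasProx S f) (hC : 0 < C) (hgr : QuadraticGrowth S f C) {x₀ : X} (hx₀ : x₀ ∈ S)
    {ε : ℝ} (hε : 0 < ε) :
    ∃ (t : ℕ → ℝ) (x : ℕ → X), x 0 = x₀ ∧ StrictMono t ∧ Tendsto t atTop atTop ∧
      ∀ n, IsScheme S f ε n t x := by
  classical
  obtain ⟨A, hA⟩ := hgr x₀ hx₀
  choose M hM0 hM using fun N : ℕ => exists_apriori_bound hC hA ((N : ℝ) + 1)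
  choose τ hτ0 hτ using fun N : ℕ => hprox x₀ hx₀ (M N) (f x₀)
  set g : ℕ → ℝ := fun N => min (τ N / 2) (min ε (1 / (16 * C))) with hg
  have hgpos : ∀ N, 0 < g N := fun N =>
    lt_min (by have := hτ0 N; positivity) (lt_min hε (by positivity))
  obtain ⟨t, ht0, hts, htm, htt⟩ := exists_times g hgpos
  -- Repeating `a` is a default that is never used: `hsch` shows along the way that a minimizer
  -- exists at every step.
  let x : ℕ → X := fun k => Nat.rec x₀ (fun k a =>
    if h : ∃ z, IsProx S f (t (k + 1) - t k) a z then h.choose else a) k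
  have hxs : ∀ k, x (k + 1) = if h : ∃ z, IsProx S f (t (k + 1) - t k) (x k) z then h.choose
    else x k := fun k => rfl
  have hsch : ∀ n, IsScheme S f (min ε (1 / (16 * C))) n t x := by
    intro n
    induction n with
    | zero =>
      exact ⟨ht0, hx₀, fun k hk => absurd hk (by omega), fun k hk => absurd hk (by omega),
        fun k hk => absurd hk (by omega)⟩
    | succ n ih =>
      have hb := hM ⌊t n⌋₊ n t x (ih.mono_mesh (min_le_right _ _)) rfl n le_rfl
        (Nat.lt_floor_add_one (t n)).le
      have hf := (ih.energy_dist (Nat.zero_le n) le_rfl).1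
      have hstep : t (n + 1) - t n = g ⌊t n⌋₊ := by rw [hts]; ring
      have hex : ∃ z, IsProx S f (t (n + 1) - t n) (x n) z := by
        rw [hstep]
        refine hτ ⌊t n⌋₊ (x n) (ih.mem n le_rfl) hb.1 hf _ (hgpos _) ?_
        exact (min_le_left _ _).trans_lt (half_lt_self (hτ0 _))
      have hp : IsProx S f (t (n + 1) - t n) (x n) (x (n + 1)) := by
        rw [hxs, dif_pos hex]; exact hex.choose_spec
      refine ⟨ht0, hx₀, fun k _ => htm (Nat.lt_succ_self k), fun k _ => ?_, fun k hk => ?_⟩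
      · rw [hts]
        exact add_le_add le_rfl (min_le_right _ _)
      · rcases Nat.lt_succ_iff_lt_or_eq.1 hk with hk | rfl
        · exact ih.prox k hk
        · exact hp
  exact ⟨t, x, rfl, htm, htt, fun n => (hsch n).mono_mesh (min_le_left _ _)⟩

/-! ### Existence, uniqueness and contraction of gradient curves -/

section GradientCurve

variable {X : Type*} [MetricSpace X] {φ : X → EReal} {lam r K C : ℝ}

lemma IsGradientCurve.sq_dist_le_of_close (hbot : ∀ x, φ x ≠ ⊥)
    (hevi : LocalEVI (dom φ) (fun w => (φ w).toReal) lam r K) (hr : 0 < r) (hK : 0 ≤ K)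
    (hC : 0 < C) (hgr : QuadraticGrowth (dom φ) (fun w => (φ w).toReal) C) {x₀ y₀ : X}
    (hx₀ : x₀ ∈ dom φ) (hy₀ : y₀ ∈ dom φ) {ξ ζ : ℝ≥0 → X} (hξ : IsGradientCurve φ x₀ ξ)
    (hζ : IsGradientCurve φ y₀ ζ) (t : ℝ≥0)
    (hd : Real.exp (2 * (2 * |lam| + 1) * (t + 1)) * dist x₀ y₀ ^ 2 < (r / 4) ^ 2) :
    Real.exp (lam * (t + t)) * dist (ξ t) (ζ t) ^ 2 ≤ dist x₀ y₀ ^ 2 := by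
  obtain ⟨P, x, hPm, hPx, hPt⟩ := hξ
  obtain ⟨Q, y, hQm, hQy, hQt⟩ := hζ
  refine le_of_forall_pos_le_add fun δ hδ => ?_
  have hev := hevi.eventually_exp_sq_dist_le hr hK hC hgr hx₀ hy₀
    (show (0 : ℝ) ≤ t + 1 by positivity) hd hδ
  -- The summand `1 / (i + 1)` makes `e i` positive. `toReal` sends an infinite mesh to `0`, so `e
  -- i` dominates the meshes only for large `i`.
  set e : ℕ → ℝ := fun i => max (P i).mesh.toReal (Q i).mesh.toReal + 1 / ((i : ℝ) + 1) with he
  have he0 : ∀ i, 0 < e i := fun i => by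
    have : 0 ≤ max (P i).mesh.toReal (Q i).mesh.toReal := le_max_of_le_left ENNReal.toReal_nonneg
    have : 0 < 1 / ((i : ℝ) + 1) := by positivity
    simp only [he]; linarith
  have het : Tendsto e atTop (𝓝 0) := by
    have h1 := (ENNReal.tendsto_toReal ENNReal.zero_ne_top).comp hPm
    have h2 := (ENNReal.tendsto_toReal ENNReal.zero_ne_top).comp hQm
    have h3 := (h1.max h2).add (tendsto_one_div_add_atTop_nhds_zero_nat (𝕜 := ℝ))
    simpa [he] using h3
  have het' : Tendsto e atTop (𝓝[>] 0) :=
    tendsto_nhdsWithin_iff.2 ⟨het, Eventually.of_forall he0⟩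
  have hPe : ∀ᶠ i in atTop, (P i).mesh ≤ ENNReal.ofReal (e i) := by
    filter_upwards [hPm.eventually_lt_const ENNReal.zero_lt_top] with i hi
    rw [← ENNReal.ofReal_toReal hi.ne]
    refine ENNReal.ofReal_le_ofReal ((le_max_left _ (Q i).mesh.toReal).trans ?_)
    exact le_add_of_nonneg_right (by positivity)
  have hQe : ∀ᶠ i in atTop, (Q i).mesh ≤ ENNReal.ofReal (e i) := by
    filter_upwards [hQm.eventually_lt_const ENNReal.zero_lt_top] with i hi
    rw [← ENNReal.ofReal_toReal hi.ne]
    refine ENNReal.ofReal_le_ofReal ((le_max_right (P i).mesh.toReal _).trans ?_)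
    exact le_add_of_nonneg_right (by positivity)
  have hidx : ∀ᶠ i in atTop, ∃ p q : ℝ, (t : ℝ) ≤ p ∧ p ≤ t + e i ∧ (t : ℝ) ≤ q ∧ q ≤ t + e i ∧
      Real.exp ((lam - 2 * lam ^ 2 * e i) * (p + q)) *
        dist ((P i).interp (x i) t) ((Q i).interp (y i) t) ^ 2 ≤ dist x₀ y₀ ^ 2 + δ := by
    filter_upwards [het'.eventually hev, hPe, hQe,
      het.eventually_le_const (show (0 : ℝ) < 1 by norm_num)] with i h1 h2 h3 h4
    obtain ⟨n, hn1, hn2, hn⟩ := (P i).exists_interp_eq (X := X) (he0 i).le h2 t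
    obtain ⟨m, hm1, hm2, hm⟩ := (Q i).exists_interp_eq (X := X) (he0 i).le h3 t
    refine ⟨_, _, hn1, hn2, hm1, hm2, ?_⟩
    rw [hn, hm]
    exact h1 n m _ _ _ _ ((hPx i).isScheme hbot hx₀ (he0 i).le h2 n)
      ((hQy i).isScheme hbot hy₀ (he0 i).le h3 m) (hPx i).1 (hQy i).1 (by linarith) (by linarith)
      (abs_le.2 ⟨by linarith, by linarith⟩)
  obtain ⟨N, hN⟩ := eventually_atTop.1 hidx
  choose! p q hp1 hp2 hq1 hq2 hpq using hN
  have hpt : Tendsto p atTop (𝓝 (t : ℝ)) := by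
    refine tendsto_of_tendsto_of_tendsto_of_le_of_le' (g := fun _ => (t : ℝ))
      (h := fun i => t + e i) tendsto_const_nhds ?_ ?_ ?_
    · simpa using het.const_add (t : ℝ)
    · exact eventually_atTop.2 ⟨N, hp1⟩
    · exact eventually_atTop.2 ⟨N, hp2⟩
  have hqt : Tendsto q atTop (𝓝 (t : ℝ)) := by
    refine tendsto_of_tendsto_of_tendsto_of_le_of_le' (g := fun _ => (t : ℝ))
      (h := fun i => t + e i) tendsto_const_nhds ?_ ?_ ?_
    · simpa using het.const_add (t : ℝ)
    · exact eventually_atTop.2 ⟨N, hq1⟩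
    · exact eventually_atTop.2 ⟨N, hq2⟩
  have hμt : Tendsto (fun i => lam - 2 * lam ^ 2 * e i) atTop (𝓝 lam) := by
    simpa using (het.const_mul (2 * lam ^ 2)).const_sub lam
  have hlim := ((Real.continuous_exp.tendsto _).comp (hμt.mul (hpt.add hqt))).mul
    (((hPt t).dist (hQt t)).pow 2)
  exact le_of_tendsto hlim (eventually_atTop.2 ⟨N, hpq⟩)

/-- Two discrete solutions from the same point satisfy the closeness condition automatically, so the
comparison estimate makes the interpolations Cauchy at each time. -/
lemma exists_isGradientCurve [CompleteSpace X] (hbot : ∀ x, φ x ≠ ⊥)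
    (hevi : LocalEVI (dom φ) (fun w => (φ w).toReal) lam r K) (hr : 0 < r) (hK : 0 ≤ K)
    (hC : 0 < C) (hgr : QuadraticGrowth (dom φ) (fun w => (φ w).toReal) C)
    (hprox : HasProx (dom φ) (fun w => (φ w).toReal)) {x₀ : X} (hx₀ : x₀ ∈ dom φ) :
    ∃ ξ : ℝ≥0 → X, IsGradientCurve φ x₀ ξ := by
  choose t x hx0 htm htt hsch using fun i : ℕ =>
    hprox.exists_scheme hC hgr hx₀ (show (0 : ℝ) < 1 / ((i : ℝ) + 1) by positivity)
  let P : ℕ → TimePartition := fun i => ⟨t i, (hsch i 0).time_zero, htm i, htt i⟩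
  have hmesh : ∀ i, (P i).mesh ≤ ENNReal.ofReal (1 / ((i : ℝ) + 1)) := fun i =>
    (P i).mesh_le fun k => (hsch i (k + 1)).succ_le k (Nat.lt_succ_self k)
  have hcauchy : ∀ s : ℝ≥0, CauchySeq fun i => (P i).interp (x i) s := by
    intro s
    rw [Metric.cauchySeq_iff]
    intro η hη
    set b := 2 * |lam| + 1 with hb
    set T : ℝ := s + 1 with hT
    -- The weight in the estimate is at least `exp (-(4bT))`; with this `δ`, dividing by it leaves
    -- `η² / 2`.
    have hev := hevi.eventually_exp_sq_dist_le hr hK hC hgr hx₀ hx₀ (T := T) (by positivity)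
      (by simp; positivity) (δ := η ^ 2 / 2 * Real.exp (-(4 * b * T))) (by positivity)
    have hone : ∀ᶠ ε : ℝ in 𝓝[>] 0, b * ε ≤ 1 ∧ ε ≤ 1 := by
      have c1 : Tendsto (fun ε : ℝ => b * ε) (𝓝[>] 0) (𝓝 0) := by
        have : Continuous fun ε : ℝ => b * ε := by fun_prop
        simpa using (this.tendsto 0).mono_left (nhdsWithin_le_nhds (s := Set.Ioi (0 : ℝ)))
      have c2 : Tendsto (fun ε : ℝ => ε) (𝓝[>] 0) (𝓝 0) := nhdsWithin_le_nhds
      exact (c1.eventually_le_const one_pos).and (c2.eventually_le_const one_pos)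
    obtain ⟨ε, hεev, ⟨hbε, hε1⟩, hε0⟩ := (hev.and (hone.and self_mem_nhdsWithin)).exists
    have hε0 : 0 < ε := hε0
    obtain ⟨N, hN⟩ := exists_nat_one_div_lt hε0
    have hN' : ∀ i ≥ N, (1 : ℝ) / (i + 1) ≤ ε := fun i hi =>
      (Nat.one_div_le_one_div hi).trans hN.le
    refine ⟨N, fun i hi j hj => ?_⟩
    have hmi := (hmesh i).trans (ENNReal.ofReal_le_ofReal (hN' i hi))
    have hmj := (hmesh j).trans (ENNReal.ofReal_le_ofReal (hN' j hj))
    obtain ⟨n, hn1, hn2, hn⟩ := (P i).exists_interp_eq (X := X) hε0.le hmi s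
    obtain ⟨m, hm1, hm2, hm⟩ := (P j).exists_interp_eq (X := X) hε0.le hmj s
    rw [hn, hm]
    have key := hεev n m (t i) (t j) (x i) (x j) ((hsch i n).mono_mesh (hN' i hi))
      ((hsch j m).mono_mesh (hN' j hj)) (hx0 i) (hx0 j) (hn2.trans (by linarith))
      (hm2.trans (by linarith)) (abs_le.2 ⟨by linarith, by linarith⟩)
    rw [dist_self] at key
    change (s : ℝ) ≤ t i n at hn1
    change t i n ≤ s + ε at hn2
    change (s : ℝ) ≤ t j m at hm1
    change t j m ≤ s + ε at hm2
    have hs0 : (0 : ℝ) ≤ s := s.2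
    have hlam : -(2 * b) ≤ lam - 2 * lam ^ 2 * ε := by
      have h1 : |lam| * ε ≤ 1 := by nlinarith [abs_nonneg lam]
      have h2 : lam ^ 2 * ε ≤ |lam| := by
        rw [← sq_abs]; nlinarith [abs_nonneg lam]
      linarith [neg_abs_le lam, abs_nonneg lam]
    have hexp : Real.exp (-(4 * b * T)) ≤
        Real.exp ((lam - 2 * lam ^ 2 * ε) * (t i n + t j m)) := by
      refine Real.exp_le_exp.2 ?_
      have h3 : -(2 * b) * (t i n + t j m) ≤ (lam - 2 * lam ^ 2 * ε) * (t i n + t j m) :=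
        mul_le_mul_of_nonneg_right hlam (by linarith)
      have h4 : 2 * b * (t i n + t j m) ≤ 2 * b * (T + T) :=
        mul_le_mul_of_nonneg_left (by linarith) (by positivity)
      linarith
    have h5 := mul_le_mul_of_nonneg_right hexp (sq_nonneg (dist (x i n) (x j m)))
    have h6 : Real.exp (-(4 * b * T)) * dist (x i n) (x j m) ^ 2 ≤
        Real.exp (-(4 * b * T)) * (η ^ 2 / 2) := by linarith
    have h7 := le_of_mul_le_mul_left h6 (Real.exp_pos _)
    have h8 : dist (x i n) (x j m) ^ 2 < η ^ 2 := by
      have : 0 < η ^ 2 := by positivity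
      linarith
    exact lt_of_pow_lt_pow_left₀ 2 hη.le h8
  choose ξ hξ using fun s => cauchySeq_tendsto_of_complete (hcauchy s)
  refine ⟨ξ, P, x, ?_, fun i => ⟨hx0 i, fun k =>
    ((hsch i (k + 1)).prox k (Nat.lt_succ_self k)).mem_minimizers hbot⟩, hξ⟩
  refine tendsto_of_tendsto_of_tendsto_of_le_of_le tendsto_const_nhds ?_ (fun _ => zero_le) hmesh
  simpa using ENNReal.tendsto_ofReal (tendsto_one_div_add_atTop_nhds_zero_nat (𝕜 := ℝ))

lemma IsGradientCurve.eq (hbot : ∀ x, φ x ≠ ⊥)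
    (hevi : LocalEVI (dom φ) (fun w => (φ w).toReal) lam r K) (hr : 0 < r) (hK : 0 ≤ K)
    (hC : 0 < C) (hgr : QuadraticGrowth (dom φ) (fun w => (φ w).toReal) C) {x₀ : X}
    (hx₀ : x₀ ∈ dom φ) {ξ ζ : ℝ≥0 → X} (hξ : IsGradientCurve φ x₀ ξ)
    (hζ : IsGradientCurve φ x₀ ζ) : ξ = ζ := by
  funext t
  have h := hξ.sq_dist_le_of_close hbot hevi hr hK hC hgr hx₀ hx₀ hζ t (by simp; positivity)
  rw [dist_self, zero_pow two_ne_zero] at h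
  have h1 : dist (ξ t) (ζ t) ^ 2 ≤ 0 := nonpos_of_mul_nonpos_right h (Real.exp_pos _)
  exact dist_eq_zero.1 (pow_eq_zero_iff two_ne_zero |>.1 (le_antisymm h1 (sq_nonneg _)))

/-- A local discrete evolution variational inequality gives existence, uniqueness and contraction
of gradient curves, provided that the domain is geodesic. -/
theorem LocalEVI.gradientCurve [CompleteSpace X] (hbot : ∀ x, φ x ≠ ⊥)
    (hevi : LocalEVI (dom φ) (fun w => (φ w).toReal) lam r K) (hr : 0 < r) (hK : 0 ≤ K)
    (hC : 0 < C) (hgr : QuadraticGrowth (dom φ) (fun w => (φ w).toReal) C)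
    (hprox : HasProx (dom φ) (fun w => (φ w).toReal))
    (hgeo : ∀ x ∈ dom φ, ∀ y ∈ dom φ, ∃ γ : ℝ → X, IsMinGeodesic γ x y ∧
      ∀ t ∈ Set.Icc (0 : ℝ) 1, γ t ∈ dom φ) :
    (∀ x₀ ∈ dom φ, ∃! ξ : ℝ≥0 → X, IsGradientCurve φ x₀ ξ) ∧
    ∀ x₀ ∈ dom φ, ∀ y₀ ∈ dom φ, ∀ ξ ζ : ℝ≥0 → X,
      IsGradientCurve φ x₀ ξ → IsGradientCurve φ y₀ ζ →
      ∀ t : ℝ≥0, dist (ξ t) (ζ t) ≤ Real.exp (-lam * (t : ℝ)) * dist x₀ y₀ := by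
  refine ⟨fun x₀ hx₀ => ?_, fun x₀ hx₀ y₀ hy₀ ξ ζ hξ hζ t => ?_⟩
  · obtain ⟨ξ, hξ⟩ := exists_isGradientCurve hbot hevi hr hK hC hgr hprox hx₀
    exact ⟨ξ, hξ, fun ζ hζ => hζ.eq hbot hevi hr hK hC hgr hx₀ hξ⟩
  obtain ⟨γ, ⟨hγ0, hγ1, hγ⟩, hγd⟩ := hgeo x₀ hx₀ y₀ hy₀
  set G := Real.exp (2 * (2 * |lam| + 1) * (t + 1)) with hG
  have hG0 : 0 < G := Real.exp_pos _
  -- Consecutive points of the division of the geodesic into `N + 1` equal pieces are close enough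
  -- for the local contraction at time `t`. On a minimal geodesic their distances sum exactly to
  -- `dist x₀ y₀`.
  obtain ⟨N, hN⟩ : ∃ N : ℕ, G * (dist x₀ y₀ * (1 / ((N : ℝ) + 1))) ^ 2 < (r / 4) ^ 2 := by
    have h1 : Tendsto (fun N : ℕ => G * (dist x₀ y₀ * (1 / ((N : ℝ) + 1))) ^ 2) atTop (𝓝 0) := by
      simpa using (((tendsto_one_div_add_atTop_nhds_zero_nat (𝕜 := ℝ)).const_mul
        (dist x₀ y₀)).pow 2).const_mul G
    exact (h1.eventually_lt_const (show 0 < (r / 4) ^ 2 by positivity)).exists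
  set n : ℝ := (N : ℝ) + 1 with hn
  have hn0 : 0 < n := by positivity
  have hmem : ∀ k : ℕ, k ≤ N + 1 → (k : ℝ) / n ∈ Set.Icc (0 : ℝ) 1 := fun k hk => by
    refine ⟨by positivity, ?_⟩
    rw [div_le_one hn0, hn]
    exact_mod_cast hk
  have hcurve : ∀ k : ℕ, ∃ c : ℝ≥0 → X, k ≤ N + 1 → IsGradientCurve φ (γ (k / n)) c := by
    intro k
    by_cases hk : k ≤ N + 1
    · obtain ⟨c, hc⟩ := exists_isGradientCurve hbot hevi hr hK hC hgr hprox (hγd _ (hmem k hk))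
      exact ⟨c, fun _ => hc⟩
    · exact ⟨ξ, fun h => absurd h hk⟩
  choose c hc using hcurve
  have hstep : ∀ k < N + 1, dist (c k t) (c (k + 1) t) ≤
      Real.exp (-lam * t) * (dist x₀ y₀ * (1 / n)) := by
    intro k hk
    have hd : dist (γ ((k : ℝ) / n)) (γ (((k + 1 : ℕ) : ℝ) / n)) = dist x₀ y₀ * (1 / n) := by
      rw [hγ _ (hmem k hk.le) _ (hmem (k + 1) hk)]
      have : (k : ℝ) / n - ((k + 1 : ℕ) : ℝ) / n = -(1 / n) := by push_cast; ring
      rw [this, abs_neg, abs_of_pos (by positivity), mul_comm]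
    have h1 := (hc k hk.le).sq_dist_le_of_close hbot hevi hr hK hC hgr (hγd _ (hmem k hk.le))
      (hγd _ (hmem (k + 1) hk)) (hc (k + 1) hk) t (by rw [hd]; exact hN)
    rw [hd] at h1
    have h2 : dist (c k t) (c (k + 1) t) ^ 2 ≤
        (Real.exp (-lam * t) * (dist x₀ y₀ * (1 / n))) ^ 2 := by
      have e1 : Real.exp (-lam * t) ^ 2 * Real.exp (lam * (t + t)) = 1 := by
        rw [← Real.exp_nat_mul, ← Real.exp_add, ← Real.exp_zero]
        congr 1; push_cast; ring
      have h3 := mul_le_mul_of_nonneg_left h1 (sq_nonneg (Real.exp (-lam * t)))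
      rw [← mul_assoc, e1, one_mul] at h3
      rw [mul_pow]; exact h3
    exact (sq_le_sq₀ dist_nonneg (by positivity)).1 h2
  have hsum : ∀ k ≤ N + 1, dist (c 0 t) (c k t) ≤
      k * (Real.exp (-lam * t) * (dist x₀ y₀ * (1 / n))) := by
    intro k
    induction k with
    | zero => intro; simp
    | succ k ih =>
      intro hk
      have h1 := ih (by omega)
      have h2 := hstep k (by omega)
      have h3 := dist_triangle (c 0 t) (c k t) (c (k + 1) t)
      push_cast
      linarith
  have hξ' : c 0 = ξ := by
    have h := hc 0 (Nat.zero_le _)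
    rw [Nat.cast_zero, zero_div, hγ0] at h
    exact h.eq hbot hevi hr hK hC hgr hx₀ hξ
  have hζ' : c (N + 1) = ζ := by
    have h := hc (N + 1) le_rfl
    have e : ((N + 1 : ℕ) : ℝ) / n = 1 := by rw [hn]; push_cast; field_simp
    rw [e, hγ1] at h
    exact h.eq hbot hevi hr hK hC hgr hy₀ hζ
  have h := hsum (N + 1) le_rfl
  rw [hξ', hζ'] at h
  refine h.trans (le_of_eq ?_)
  rw [hn]; push_cast; field_simp

end GradientCurve

/-! ### Consequences of semi-convexity -/

section SemiConvex

variable {X : Type*} [MetricSpace X] {φ : X → EReal} {lam : ℝ} {Γ : Set (ℝ → X)}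

lemma IsLambdaConvex.exists_geodesic (hbot : ∀ x, φ x ≠ ⊥) (h : IsLambdaConvex Γ lam φ) {x y : X}
    (hx : x ∈ dom φ) (hy : y ∈ dom φ) :
    ∃ γ ∈ Γ, IsMinGeodesic γ x y ∧ ∀ t ∈ Set.Icc (0 : ℝ) 1, γ t ∈ dom φ ∧
      (φ (γ t)).toReal ≤ (1 - t) * (φ x).toReal + t * (φ y).toReal
        - lam / 2 * (1 - t) * t * dist x y ^ 2 := by
  obtain ⟨γ, hγ, hg, hc⟩ := h x hx y hy
  refine ⟨γ, hγ, hg, fun t ht => ?_⟩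
  have h1 := hc t ht
  have h2 : γ t ∈ dom φ := fun htop => by
    rw [htop] at h1
    exact EReal.coe_ne_top _ (top_le_iff.1 h1)
  refine ⟨h2, ?_⟩
  rwa [← coe_toReal_of_mem_dom hbot h2, EReal.coe_le_coe_iff] at h1

/-- A lower semi-continuous semi-convex function decays at most quadratically. -/
lemma IsLambdaConvex.quadraticGrowth (hbot : ∀ x, φ x ≠ ⊥) (hlsc : LowerSemicontinuous φ)
    (h : IsLambdaConvex Γ lam φ) :
    QuadraticGrowth (dom φ) (fun w => (φ w).toReal) (1 + |lam| / 2) := by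
  intro x₀ hx₀
  obtain ⟨ρ, hρ0, hρ⟩ : ∃ ρ > 0, ∀ y, dist y x₀ < ρ → (((φ x₀).toReal - 1 : ℝ) : EReal) < φ y := by
    have := hlsc x₀ (((φ x₀).toReal - 1 : ℝ) : EReal) (by
      change (((φ x₀).toReal - 1 : ℝ) : EReal) < φ x₀
      conv_rhs => rw [← coe_toReal_of_mem_dom hbot hx₀]
      rw [EReal.coe_lt_coe_iff]; linarith)
    exact Metric.eventually_nhds_iff.1 this
  have hball : ∀ y ∈ dom φ, dist x₀ y < ρ → (φ x₀).toReal - 1 ≤ (φ y).toReal := by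
    intro y hy hd
    have := hρ y (by rwa [dist_comm])
    rw [← coe_toReal_of_mem_dom hbot hy, EReal.coe_lt_coe_iff] at this
    exact this.le
  refine ⟨1 / (ρ / 2) ^ 2 + 1 - (φ x₀).toReal, fun y hy => ?_⟩
  dsimp only
  set L := dist x₀ y with hL
  have hL0 : 0 ≤ L := dist_nonneg
  have hpos : 0 < 1 / (ρ / 2) ^ 2 := by positivity
  have hCL : 0 ≤ (1 + |lam| / 2) * L ^ 2 := by positivity
  rcases lt_or_ge L ρ with hlt | hge
  · linarith [hball y hy hlt]
  obtain ⟨γ, -, ⟨hγ0, hγ1, hγ⟩, hc⟩ := h.exists_geodesic hbot hx₀ hy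
  set σ := ρ / 2 with hσ
  have hσ0 : 0 < σ := by positivity
  have hLpos : 0 < L := hρ0.trans_le hge
  -- The point of the geodesic at distance `ρ / 2` from `x₀` lies in the ball where lower
  -- semi-continuity bounds `φ` below; convexity extrapolates this bound to `y`.
  set t := σ / L with ht
  have ht0 : 0 < t := by positivity
  have htL : t * L = σ := by rw [ht]; field_simp
  have ht1 : t ≤ 1 := by
    rw [ht, div_le_one hLpos]; linarith
  obtain ⟨hd, hf⟩ := hc t ⟨ht0.le, ht1⟩
  have hdist : dist x₀ (γ t) = σ := by
    have := hγ 0 ⟨le_rfl, zero_le_one⟩ t ⟨ht0.le, ht1⟩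
    rw [hγ0, zero_sub, abs_neg, abs_of_pos ht0] at this
    rw [this, ← hL, htL]
  have h1 := hball _ hd (by rw [hdist]; linarith)
  have h2 : -(|lam| / 2 * (t * L ^ 2)) ≤ lam / 2 * (1 - t) * t * L ^ 2 := by
    have h3 : 0 ≤ (1 - t) * (t * L ^ 2) := mul_nonneg (by linarith) (by positivity)
    have h4 : (1 - t) * (t * L ^ 2) ≤ t * L ^ 2 := by
      have : 0 ≤ t * (t * L ^ 2) := by positivity
      linarith
    have h5 := mul_le_mul_of_nonneg_right (neg_abs_le lam) h3
    have h6 := mul_le_mul_of_nonneg_left h4 (abs_nonneg lam)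
    linarith
  have h3 : t * ((φ x₀).toReal - L / σ - |lam| / 2 * L ^ 2) ≤ t * (φ y).toReal := by
    have : t * (L / σ) = 1 := by rw [← mul_div_assoc, htL, div_self hσ0.ne']
    linarith
  have h4 := le_of_mul_le_mul_left h3 ht0
  have h5 : L / σ ≤ 1 / σ ^ 2 + L ^ 2 := by
    have h6 := sq_nonneg (1 / σ - L)
    have h7 : L / σ = 1 / σ * L := by ring
    have h8 : 1 / σ ^ 2 = (1 / σ) ^ 2 := by ring
    have h9 : 0 ≤ 1 / σ * L := by positivity
    rw [h7, h8]; nlinarith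
  linarith

/-- The first-order condition for a minimizer along a geodesic. -/
lemma IsProx.first_order {S : Set X} {f : X → ℝ} {τ l : ℝ} {x y z : X} (hz : IsProx S f τ x z)
    (hτ : 0 < τ) {γ : ℝ → X} {u : ℝ → ℝ}
    (hγ : ∀ t ∈ Set.Icc (0 : ℝ) 1, γ t ∈ S ∧
      f (γ t) ≤ (1 - t) * f z + t * f y - lam / 2 * (1 - t) * t * dist z y ^ 2)
    (hu : ∀ s, 0 < s → s < 1 → dist x (γ s) ^ 2 - dist x z ^ 2 ≤ s * u s)
    (hl : Tendsto u (𝓝[>] 0) (𝓝 l)) :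
    lam * τ * dist z y ^ 2 ≤ 2 * τ * (f y - f z) + l := by
  -- Comparison of `z` with `γ s`, divided by `s`. Only a majorant `u` of the difference quotient of
  -- `d²(x, γ ·)` is needed, not its derivative.
  have h1 : ∀ᶠ s : ℝ in 𝓝[>] 0,
      lam * τ * (1 - s) * dist z y ^ 2 ≤ 2 * τ * (f y - f z) + u s := by
    filter_upwards [Ioo_mem_nhdsGT (zero_lt_one' ℝ)] with s hs
    obtain ⟨hs1, hs2⟩ := hγ s ⟨hs.1.le, hs.2.le⟩
    have h2 := hz.2 _ hs1
    have h3 := hu s hs.1 hs.2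
    have h4 : dist x (γ s) ^ 2 / (2 * τ) ≤ dist x z ^ 2 / (2 * τ) + s * u s / (2 * τ) := by
      rw [← add_div]
      exact div_le_div_of_nonneg_right (by linarith) (by positivity)
    have h5 : lam / 2 * (1 - s) * s * dist z y ^ 2 ≤ s * (f y - f z) + s * u s / (2 * τ) := by
      linarith
    have h6 := mul_le_mul_of_nonneg_left h5 (by positivity : 0 ≤ 2 * τ)
    have e : 2 * τ * (s * (f y - f z) + s * u s / (2 * τ)) =
        s * (2 * τ * (f y - f z) + u s) := by field_simp
    rw [e] at h6
    refine le_of_mul_le_mul_left ?_ hs.1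
    linarith
  have hc : Tendsto (fun s : ℝ => lam * τ * (1 - s) * dist z y ^ 2) (𝓝[>] 0)
      (𝓝 (lam * τ * dist z y ^ 2)) := by
    have : Continuous fun s : ℝ => lam * τ * (1 - s) * dist z y ^ 2 := by fun_prop
    simpa using (this.tendsto 0).mono_left (nhdsWithin_le_nhds (s := Set.Ioi (0 : ℝ)))
  exact le_of_tendsto_of_tendsto hc (hl.const_add _) h1

/-! ### Squared distances that are semi-convex and commute -/

/-- The slope of `d²(·, x)` from `z` towards `y` equals that of `d²(·, y)` from `z` towards `x`. The
latter is bounded by `K`-convexity, at the cost of `|K|/2 · d²(x,z)`. -/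
lemma SqDistCommutes.localEVI {K : ℝ} (hbot : ∀ x, φ x ≠ ⊥) (hconv : IsLambdaConvex Γ lam φ)
    (hK : SqDistConvex Γ K) (hcomm : SqDistCommutes Γ) (r : ℝ) :
    LocalEVI (dom φ) (fun w => (φ w).toReal) lam r (|K| / 2) := by
  intro τ hτ x hx z hz y hy _ _ _
  obtain ⟨γ, hγΓ, hγ, hγc⟩ := hconv.exists_geodesic hbot hz.1 hy
  obtain ⟨η, hηΓ, hη, -⟩ := hconv.exists_geodesic hbot hz.1 hx
  obtain ⟨l, hl1, hl2⟩ := hcomm γ hγΓ η hηΓ z y x hγ hη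
  have h1 := hz.first_order hτ hγc (l := l)
    (u := fun s => (dist (γ s) x ^ 2 - dist z x ^ 2) / s)
    (fun s hs0 _ => by
      rw [mul_div_cancel₀ _ hs0.ne', dist_comm x, dist_comm x]) hl1
  have h2 : l ≤ dist x y ^ 2 - dist z y ^ 2 + |K| / 2 * dist x z ^ 2 := by
    refine le_of_tendsto hl2 ?_
    filter_upwards [Ioo_mem_nhdsGT (zero_lt_one' ℝ)] with t ht
    rw [div_le_iff₀ ht.1]
    have h3 := hK η hηΓ z x hη y t ⟨ht.1.le, ht.2.le⟩
    rw [dist_comm z x] at h3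
    have h4 : 0 ≤ (1 - t) * t * dist x z ^ 2 :=
      mul_nonneg (mul_nonneg (by linarith [ht.2]) ht.1.le) (sq_nonneg _)
    have h5 := mul_le_mul_of_nonneg_right (neg_abs_le K) h4
    have h6 : (1 - t) * t * dist x z ^ 2 ≤ t * dist x z ^ 2 := by
      have : 0 ≤ t * t * dist x z ^ 2 := mul_nonneg (mul_self_nonneg t) (sq_nonneg _)
      linarith
    have h7 := mul_le_mul_of_nonneg_left h6 (abs_nonneg K)
    linarith
  dsimp only at h1 ⊢
  linarith

lemma IsCoercive.hasProx (hbot : ∀ x, φ x ≠ ⊥) (h : IsCoercive φ) :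
    HasProx (dom φ) (fun w => (φ w).toReal) := by
  obtain ⟨τs, hτs, hc⟩ := h
  refine fun x₀ _ R M => ⟨τs, hτs, fun x hx _ _ τ hτ0 hτ => ?_⟩
  obtain ⟨z, hz⟩ := (hc x τ hτ0 hτ).2
  exact ⟨z, isProx_of_mem_minimizers hbot hx hz⟩

end SemiConvex

/-! ### Trigonometric inequalities -/

lemma mul_sinc (x : ℝ) : x * Real.sinc x = Real.sin x := by
  by_cases hx : x = 0
  · simp [hx]
  · rw [Real.sinc_of_ne_zero hx]; field_simp

lemma sinc_pos {x : ℝ} (h0 : 0 ≤ x) (hπ : x < Real.pi) : 0 < Real.sinc x := by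
  rcases h0.eq_or_lt with rfl | h0
  · simp
  · rw [Real.sinc_of_ne_zero h0.ne']
    exact div_pos (Real.sin_pos_of_pos_of_lt_pi h0 hπ) h0

lemma mul_cos_le_sin {x : ℝ} (h0 : 0 ≤ x) (hπ : x ≤ Real.pi) : x * Real.cos x ≤ Real.sin x := by
  rcases lt_or_ge x (Real.pi / 2) with h | h
  · have hc : 0 < Real.cos x := Real.cos_pos_of_mem_Ioo ⟨by linarith [Real.pi_pos], h⟩
    have := Real.le_tan h0 h
    rwa [Real.tan_eq_sin_div_cos, le_div_iff₀ hc] at this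
  · have h1 := Real.cos_nonpos_of_pi_div_two_le_of_le h (by linarith [Real.pi_pos])
    have h2 := Real.sin_nonneg_of_nonneg_of_le_pi h0 hπ
    nlinarith

/-- Chords of the concave function `sin` from the origin have decreasing slope. -/
lemma sinc_antitone {x y : ℝ} (hx : 0 ≤ x) (hxy : x ≤ y) (hy : y ≤ Real.pi) :
    Real.sinc y ≤ Real.sinc x := by
  rcases hx.eq_or_lt with rfl | hx
  · simpa using Real.sinc_le_one y
  have hy0 : 0 < y := hx.trans_le hxy
  have h := strictConcaveOn_sin_Icc.concaveOn.2 (show y ∈ Set.Icc 0 Real.pi from ⟨hy0.le, hy⟩)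
    (show (0 : ℝ) ∈ Set.Icc 0 Real.pi from ⟨le_rfl, Real.pi_pos.le⟩)
    (show 0 ≤ x / y by positivity) (show 0 ≤ 1 - x / y by
      rw [sub_nonneg, div_le_one hy0]; exact hxy) (by ring)
  simp only [smul_eq_mul, Real.sin_zero, mul_zero, add_zero] at h
  rw [div_mul_cancel₀ _ hy0.ne'] at h
  rw [Real.sinc_of_ne_zero hx.ne', Real.sinc_of_ne_zero hy0.ne', div_le_div_iff₀ hy0 hx]
  rw [div_mul_eq_mul_div, div_le_iff₀ hy0] at h
  linarith

/-- The squared angle is a convex function of its cosine. -/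
lemma two_mul_cos_sub_cos_le {b c : ℝ} (hb : 0 ≤ b) (hbπ : b < Real.pi) (hc : 0 ≤ c)
    (hcπ : c < Real.pi) :
    2 * (Real.cos b - Real.cos c) ≤ Real.sinc b * (c ^ 2 - b ^ 2) := by
  -- This is a tangent-line inequality: `x²` has slope `-2 / sinc b` with respect to `cos x` at `b`.
  -- Both cases factor the difference of cosines through half-sum and half-difference.
  rcases le_or_gt b c with h | h
  · set u := (b + c) / 2 with hu
    set v := (c - b) / 2 with hv
    have e1 : Real.cos b - Real.cos c = 2 * (u * v * (Real.sinc u * Real.sinc v)) := by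
      rw [Real.cos_sub_cos, show (b - c) / 2 = -v by rw [hv]; ring, Real.sin_neg, ← hu,
        ← mul_sinc u, ← mul_sinc v]
      ring
    have e2 : c ^ 2 - b ^ 2 = 4 * (u * v) := by rw [hu, hv]; ring
    have hu0 : 0 ≤ u := by positivity
    have hv0 : 0 ≤ v := by rw [hv]; linarith
    have h1 : Real.sinc u ≤ Real.sinc b := sinc_antitone hb (by linarith) (by linarith)
    have h2 : 0 ≤ Real.sinc u := (sinc_pos hu0 (by linarith)).le
    have h3 : Real.sinc u * Real.sinc v ≤ Real.sinc b := by
      nlinarith [Real.sinc_le_one v]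
    have h4 := mul_le_mul_of_nonneg_left h3 (mul_nonneg hu0 hv0)
    rw [e1, e2]
    linarith
  · set u := (b + c) / 2 with hu
    set v := (b - c) / 2 with hv
    have hb0 : 0 < b := hc.trans_lt h
    have hu0 : 0 ≤ u := by positivity
    have hv0 : 0 ≤ v := by rw [hv]; linarith
    have huv : u + v = b := by rw [hu, hv]; ring
    have e1 : Real.cos b - Real.cos c = -(2 * (Real.sin u * Real.sin v)) := by
      rw [Real.cos_sub_cos, ← hu, ← hv]; ring
    have e2 : c ^ 2 - b ^ 2 = -(4 * (u * v)) := by rw [hu, hv]; ring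
    have h1 : u * v * Real.sin b ≤ b * (Real.sin u * Real.sin v) := by
      rw [← huv, Real.sin_add]
      have hsu := Real.sin_nonneg_of_nonneg_of_le_pi hu0 (by linarith : u ≤ Real.pi)
      have hsv := Real.sin_nonneg_of_nonneg_of_le_pi hv0 (by linarith : v ≤ Real.pi)
      have h2 := mul_le_mul_of_nonneg_left (mul_cos_le_sin hv0 (by linarith : v ≤ Real.pi))
        (mul_nonneg hu0 hsu)
      have h3 := mul_le_mul_of_nonneg_left (mul_cos_le_sin hu0 (by linarith : u ≤ Real.pi))
        (mul_nonneg hv0 hsv)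
      nlinarith
    have h2 : u * v * Real.sinc b ≤ Real.sin u * Real.sin v := by
      rw [Real.sinc_of_ne_zero hb0.ne', ← mul_div_assoc, div_le_iff₀ hb0]
      linarith
    rw [e1, e2]
    linarith

/-! ### `CAT(1)`-spaces -/

/-- Points on a spherical geodesic as linear combinations of its endpoints. -/
lemma sin_smul_eq_of_inner {E : Type*} [NormedAddCommGroup E] [InnerProductSpace ℝ E]
    {b c w : E} {p q : ℝ} (hb : ‖b‖ = 1) (hc : ‖c‖ = 1) (hw : ‖w‖ = 1)
    (hbc : inner ℝ b c = Real.cos (p + q)) (hwb : inner ℝ w b = Real.cos q)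
    (hwc : inner ℝ w c = Real.cos p) :
    Real.sin (p + q) • w = Real.sin p • b + Real.sin q • c := by
  -- The prescribed inner products force the squared norm of the difference to vanish; no
  -- nonvanishing of `sin (p + q)` is required.
  rw [← sub_eq_zero, ← norm_eq_zero, ← sq_eq_zero_iff, norm_sub_sq_real, norm_add_sq_real,
    inner_add_right]
  simp only [inner_smul_left, inner_smul_right, norm_smul, mul_pow, hb, hc, hw, hbc, hwb, hwc,
    Real.norm_eq_abs, sq_abs, RCLike.conj_to_real]
  rw [Real.sin_add, Real.cos_add]
  have h1 := Real.sin_sq_add_cos_sq p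
  have h2 := Real.sin_sq_add_cos_sq q
  rw [← eq_sub_iff_add_eq'] at h1 h2
  ring_nf
  rw [h1, h2]
  ring

variable {X : Type*} [MetricSpace X]

/-- Comparison in `CAT(1)`-spaces in terms of cosines. -/
lemma IsCAT1.le_cos_dist (h : IsCAT1 X) {x y z : X}
    (hper : dist x y + dist y z + dist z x < 2 * Real.pi) {γ : ℝ → X} (hγ : IsMinGeodesic γ y z)
    {t : ℝ} (ht : t ∈ Set.Icc (0 : ℝ) 1) :
    Real.sin ((1 - t) * dist y z) * Real.cos (dist x y) +
      Real.sin (t * dist y z) * Real.cos (dist x z) ≤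
        Real.sin (dist y z) * Real.cos (dist x (γ t)) := by
  obtain ⟨a, b, c, σ, ⟨ha, hb, hc, hab, hbc, hca⟩, ⟨hσ0, hσ1, hσs, hσ⟩, hle⟩ := h.2 x y z hper γ hγ
  rw [mem_sphere_zero_iff_norm] at ha hb hc
  have hw := hσs t ht
  rw [mem_sphere_zero_iff_norm] at hw
  have hcos : ∀ p q : E3, ‖p‖ = 1 → ‖q‖ = 1 → inner ℝ p q = Real.cos (sphereDist p q) := by
    intro p q hp hq
    rw [sphereDist, InnerProductGeometry.cos_angle, hp, hq, mul_one, div_one]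
  have hL : dist y z ≤ Real.pi := hbc ▸ InnerProductGeometry.angle_le_pi _ _
  have h1 := hσ t ht 0 ⟨le_rfl, zero_le_one⟩
  rw [hσ0, sub_zero, abs_of_nonneg ht.1, hbc] at h1
  have h2 := hσ t ht 1 ⟨zero_le_one, le_rfl⟩
  rw [hσ1, abs_sub_comm, abs_of_nonneg (by linarith [ht.2]), hbc] at h2
  have hadd : (1 - t) * dist y z + t * dist y z = dist y z := by ring
  have key := sin_smul_eq_of_inner (p := (1 - t) * dist y z) (q := t * dist y z) hb hc hw
    (by rw [hcos b c hb hc, hbc, hadd]) (by rw [hcos _ _ hw hb, h1]) (by rw [hcos _ _ hw hc, h2])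
  rw [hadd] at key
  have h3 := congrArg (fun v => inner ℝ a v) key
  simp only [inner_add_right, inner_smul_right] at h3
  rw [hcos a b ha hb, hcos _ _ ha hw, hcos a c ha hc, hab,
    show sphereDist a c = dist x z by
      rw [sphereDist, InnerProductGeometry.angle_comm, dist_comm x z]; exact hca] at h3
  rw [← h3]
  refine mul_le_mul_of_nonneg_left ?_ (Real.sin_nonneg_of_nonneg_of_le_pi dist_nonneg hL)
  exact Real.cos_le_cos_of_nonneg_of_le_pi dist_nonneg (InnerProductGeometry.angle_le_pi _ _)
    (hle t ht)

/-- Uniform convexity of the squared distance at midpoints in small triangles. -/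
lemma IsCAT1.sq_dist_midpoint_le (h : IsCAT1 X) {x y z : X} (hxy : dist x y ≤ 1 / 2)
    (hxz : dist x z ≤ 1 / 2) {γ : ℝ → X} (hγ : IsMinGeodesic γ y z) :
    dist x (γ (1 / 2)) ^ 2 ≤ (dist x y ^ 2 + dist x z ^ 2) / 2 - dist y z ^ 2 / 20 := by
  have hπ := Real.pi_gt_three
  have hyz : dist y z ≤ 1 := by
    have := dist_triangle_left y z x
    linarith
  have hL0 : 0 ≤ dist y z := dist_nonneg
  have h1 := h.le_cos_dist (x := x) (by rw [dist_comm z x]; linarith) hγ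
    (t := 1 / 2) ⟨by norm_num, by norm_num⟩
  have hd : dist x (γ (1 / 2)) < Real.pi := by
    have h2 := hγ.2.2 0 ⟨le_rfl, zero_le_one⟩ (1 / 2) ⟨by norm_num, by norm_num⟩
    rw [hγ.1, zero_sub, abs_neg, abs_of_pos (by norm_num)] at h2
    have := dist_triangle x y (γ (1 / 2))
    linarith
  have hd0 : 0 ≤ dist x (γ (1 / 2)) := dist_nonneg
  have t1 := two_mul_cos_sub_cos_le hd0 hd (dist_nonneg (x := x) (y := y)) (by linarith)
  have t2 := two_mul_cos_sub_cos_le hd0 hd (dist_nonneg (x := x) (y := z)) (by linarith)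
  have hs0 := sinc_pos hd0 hd
  have hs1 := Real.sinc_le_one (dist x (γ (1 / 2)))
  have hcy : 1 / 2 ≤ Real.cos (dist x y) := by
    have := Real.one_sub_sq_div_two_le_cos (x := dist x y)
    nlinarith [dist_nonneg (x := x) (y := y)]
  have hcz : 1 / 2 ≤ Real.cos (dist x z) := by
    have := Real.one_sub_sq_div_two_le_cos (x := dist x z)
    nlinarith [dist_nonneg (x := x) (y := z)]
  set L := dist y z with hL
  set d := dist x (γ (1 / 2))
  set u := (Real.cos (dist x y) + Real.cos (dist x z)) / 2 with hu
  -- Midpoint comparison reads `u ≤ cos (L/2) cos d`. The gain comes from `cos (L/2) ≤ 1 - L²/20`, a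
  -- consequence of `π² ≤ 10`, and from `cos d ≥ u ≥ 1/2`.
  have hcosd : u + L ^ 2 / 40 ≤ Real.cos d := by
    rcases hL0.eq_or_lt with h0 | hLpos
    · have hyz' : y = z := dist_eq_zero.1 h0.symm
      have h2 := hγ.2.2 0 ⟨le_rfl, zero_le_one⟩ (1 / 2) ⟨by norm_num, by norm_num⟩
      rw [hγ.1, ← hL, ← h0, mul_zero, dist_eq_zero] at h2
      rw [← h0, hu, ← hyz']
      have : d = dist x y := by rw [h2]
      rw [this]
      linarith
    · have hsin : 0 < Real.sin (L / 2) := Real.sin_pos_of_pos_of_lt_pi (by linarith) (by linarith)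
      have hcL : 0 < Real.cos (L / 2) := Real.cos_pos_of_mem_Ioo ⟨by linarith, by linarith⟩
      have h2 : u ≤ Real.cos (L / 2) * Real.cos d := by
        have e1 : (1 - 1 / 2) * L = L / 2 := by ring
        have e2 : 1 / 2 * L = L / 2 := by ring
        have e3 : Real.sin L = 2 * Real.sin (L / 2) * Real.cos (L / 2) := by
          rw [← Real.sin_two_mul]; congr 1; ring
        rw [e1, e2, e3] at h1
        refine le_of_mul_le_mul_left ?_ hsin
        rw [hu]; linarith
      have hu0 : 1 / 2 ≤ u := by rw [hu]; linarith
      have hcd : 0 < Real.cos d := by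
        by_contra hneg
        push Not at hneg
        nlinarith
      have h3 : u ≤ Real.cos d := by nlinarith [Real.cos_le_one (L / 2)]
      have h4 : Real.cos (L / 2) ≤ 1 - L ^ 2 / 20 := by
        refine (Real.cos_le_one_sub_mul_cos_sq (x := L / 2) ?_).trans ?_
        · rw [abs_of_nonneg (by linarith)]; linarith
        · have h5 : 1 / 5 ≤ 2 / Real.pi ^ 2 := by
            rw [div_le_div_iff₀ (by norm_num) (by positivity)]
            nlinarith [Real.pi_lt_d2]
          have h6 := mul_le_mul_of_nonneg_right h5 (sq_nonneg (L / 2))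
          linarith
      have h5 := mul_le_mul_of_nonneg_right h4 hcd.le
      have h6 : L ^ 2 / 20 * (1 / 2) ≤ L ^ 2 / 20 * Real.cos d :=
        mul_le_mul_of_nonneg_left (by linarith) (by positivity)
      linarith
  have t3 : 2 * (L ^ 2 / 40) ≤ Real.sinc d * ((dist x y ^ 2 + dist x z ^ 2) / 2 - d ^ 2) := by
    linarith
  have hnn : 0 ≤ (dist x y ^ 2 + dist x z ^ 2) / 2 - d ^ 2 := by
    by_contra hneg
    push Not at hneg
    nlinarith [sq_nonneg L]
  have t4 : Real.sinc d * ((dist x y ^ 2 + dist x z ^ 2) / 2 - d ^ 2) ≤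
      1 * ((dist x y ^ 2 + dist x z ^ 2) / 2 - d ^ 2) := mul_le_mul_of_nonneg_right hs1 hnn
  linarith

/-- The convexity of the squared distance on the sphere, in terms of the law of cosines. -/
lemma sphere_first_variation_le {a b c : ℝ} (ha : 0 ≤ a) (ha1 : a < 1) (hb : 0 ≤ b) (hb1 : b < 1)
    (hc : 0 ≤ c) (hc1 : c < 1) :
    2 / Real.sinc a * ((Real.cos a * Real.cos b - Real.cos c) / Real.sinc b) ≤ c ^ 2 - b ^ 2 := by
  have hπ := Real.pi_gt_three
  have hsa := sinc_pos ha (by linarith)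
  have hsb := sinc_pos hb (by linarith)
  have h1 := two_mul_cos_sub_cos_le hb (by linarith) hc (by linarith)
  have hcb : 0 ≤ Real.cos b := Real.cos_nonneg_of_mem_Icc ⟨by linarith, by linarith⟩
  have hcc : 0 ≤ Real.cos c := Real.cos_nonneg_of_mem_Icc ⟨by linarith, by linarith⟩
  have h2 : Real.cos a ≤ Real.sinc a := by
    rcases ha.eq_or_lt with rfl | ha
    · simp
    · have := mul_cos_le_sin ha.le (by linarith)
      rw [← mul_sinc] at this
      exact le_of_mul_le_mul_left this ha
  -- For a spherical triangle with angle `α` opposite `c`, the left side of the claim is `-2ab cos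
  -- α`, symmetric in `a` and `b`: the spherical form of commutativity. Here `cos a ≤ sinc a ≤ 1`
  -- removes `a` and reduces the claim to the tangent-line inequality.
  have h3 : Real.cos a * Real.cos b - Real.cos c ≤
      Real.sinc a * (Real.cos b - Real.cos c) := by
    nlinarith [mul_nonneg hcb (sub_nonneg.2 h2),
      mul_nonneg hcc (sub_nonneg.2 (Real.sinc_le_one a))]
  rw [div_mul_div_comm, div_le_iff₀ (mul_pos hsa hsb)]
  have h4 := mul_le_mul_of_nonneg_left h1 hsa.le
  linarith

/-- Distances below `1` keep the perimeter below `2π` and the cosines nonnegative. Comparison bounds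
`cos d(x, γ s)` below by an explicit function `g`; the tangent-line inequality converts this into a
majorant of `d²(x, γ s)` whose slope at `0` is the spherical one. -/
lemma IsCAT1.localEVI {φ : X → EReal} {lam : ℝ} (h : IsCAT1 X) (hbot : ∀ x, φ x ≠ ⊥)
    (hconv : IsLambdaConvex Set.univ lam φ) :
    LocalEVI (dom φ) (fun w => (φ w).toReal) lam 1 0 := by
  intro τ hτ x hx z hz y hy hxz hxy hzy
  have hπ := Real.pi_gt_three
  rcases eq_or_ne z y with rfl | hne
  · simp
  have hb0 : 0 < dist z y := dist_pos.2 hne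
  obtain ⟨γ, -, hγ, hγc⟩ := hconv.exists_geodesic hbot hz.1 hy
  set a := dist x z with ha
  set b := dist z y with hb
  set c := dist x y with hc
  have ha0 : 0 ≤ a := dist_nonneg
  have hc0 : 0 ≤ c := dist_nonneg
  have hsb : 0 < Real.sin b := Real.sin_pos_of_pos_of_lt_pi hb0 (by linarith)
  set g : ℝ → ℝ := fun s =>
    (Real.sin ((1 - s) * b) * Real.cos a + Real.sin (s * b) * Real.cos c) / Real.sin b with hg
  have hg0 : g 0 = Real.cos a := by simp [hg, hsb.ne']
  have hgd : HasDerivAt g ((-(b * Real.cos b) * Real.cos a + b * Real.cos c) / Real.sin b) 0 := by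
    have d1 : HasDerivAt (fun s : ℝ => (1 - s) * b) (-b) 0 := by
      simpa using ((hasDerivAt_id (0 : ℝ)).const_sub 1).mul_const b
    have d2 : HasDerivAt (fun s : ℝ => s * b) b 0 := by
      simpa using (hasDerivAt_id (0 : ℝ)).mul_const b
    have d3 := ((d1.sin.mul_const (Real.cos a)).add (d2.sin.mul_const (Real.cos c))).div_const
      (Real.sin b)
    refine d3.congr_deriv ?_
    simp
    ring
  have hdist : ∀ s ∈ Set.Icc (0 : ℝ) 1, |dist x (γ s) - a| ≤ s * b := by
    intro s hs
    have h1 := hγ.2.2 0 ⟨le_rfl, zero_le_one⟩ s hs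
    rw [hγ.1, zero_sub, abs_neg, abs_of_nonneg hs.1] at h1
    have h2 := abs_dist_sub_le (γ s) z x
    rw [dist_comm (γ s) x, dist_comm z x, dist_comm (γ s) z, h1] at h2
    exact h2
  have hdlt : ∀ s ∈ Set.Icc (0 : ℝ) 1, dist x (γ s) < Real.pi := by
    intro s hs
    have h1 := (abs_le.1 (hdist s hs)).2
    have h2 : s * b ≤ 1 * b := mul_le_mul_of_nonneg_right hs.2 hb0.le
    linarith
  have hd_lim : Tendsto (fun s => dist x (γ s)) (𝓝[>] 0) (𝓝 a) := by
    rw [tendsto_iff_dist_tendsto_zero]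
    refine squeeze_zero' (Eventually.of_forall fun _ => dist_nonneg)
      (g := fun s : ℝ => s * b) ?_ ?_
    · filter_upwards [Ioo_mem_nhdsGT (zero_lt_one' ℝ)] with s hs
      rw [Real.dist_eq]
      exact hdist s ⟨hs.1.le, hs.2.le⟩
    · have : Continuous fun s : ℝ => s * b := by fun_prop
      simpa using (this.tendsto 0).mono_left (nhdsWithin_le_nhds (s := Set.Ioi (0 : ℝ)))
  have hsa := sinc_pos ha0 (by linarith)
  have hlim : Tendsto (fun s => 2 / Real.sinc (dist x (γ s)) * -(s⁻¹ * (g s - g 0))) (𝓝[>] 0)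
      (𝓝 (2 / Real.sinc a * -((-(b * Real.cos b) * Real.cos a + b * Real.cos c) / Real.sin b))) := by
    refine Tendsto.mul (Tendsto.div tendsto_const_nhds
      ((Real.continuous_sinc.tendsto a).comp hd_lim) hsa.ne') (Tendsto.neg ?_)
    have h1 := (hasDerivAt_iff_tendsto_slope_zero.1 hgd).mono_left
      (nhdsWithin_mono 0 (fun s (hs : 0 < s) => hs.ne') : 𝓝[>] (0 : ℝ) ≤ 𝓝[≠] 0)
    simpa using h1
  have hfo := hz.first_order hτ hγc (fun s hs0 hs1 => ?_) hlim
  · have h1 := sphere_first_variation_le ha0 hxz hb0.le hzy hc0 hxy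
    have h2 : -((-(b * Real.cos b) * Real.cos a + b * Real.cos c) / Real.sin b) =
        (Real.cos a * Real.cos b - Real.cos c) / Real.sinc b := by
      rw [Real.sinc_of_ne_zero hb0.ne']
      field_simp
      ring
    rw [h2] at hfo
    dsimp only at hfo ⊢
    linarith
  · have hs : s ∈ Set.Icc (0 : ℝ) 1 := ⟨hs0.le, hs1.le⟩
    have h1 := two_mul_cos_sub_cos_le dist_nonneg (hdlt s hs) ha0 (by linarith : a < Real.pi)
    have hss := sinc_pos dist_nonneg (hdlt s hs)
    have h2 := h.le_cos_dist (x := x) (y := z) (z := y)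
      (by rw [dist_comm y x, ← ha, ← hb, ← hc]; linarith) hγ hs
    have h3 : g s ≤ Real.cos (dist x (γ s)) := by
      rw [hg]
      dsimp only
      rw [div_le_iff₀ hsb]
      linarith
    have e : s * (2 / Real.sinc (dist x (γ s)) * -(s⁻¹ * (g s - g 0))) =
        2 * (g 0 - g s) / Real.sinc (dist x (γ s)) := by
      field_simp
      ring
    rw [e, le_div_iff₀ hss, hg0]
    linarith

/-- Direct method: for small `τ` near-minimizers stay within `1/2` of `x`, where the quadratic term
is uniformly convex and outweighs the possible concavity of `φ`. Minimizing sequences are therefore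
Cauchy, and no compactness is involved. -/
lemma IsCAT1.hasProx [CompleteSpace X] {φ : X → EReal} {lam C : ℝ} (h : IsCAT1 X)
    (hbot : ∀ x, φ x ≠ ⊥) (hlsc : LowerSemicontinuous φ) (hconv : IsLambdaConvex Set.univ lam φ)
    (hC : 0 < C) (hgr : QuadraticGrowth (dom φ) (fun w => (φ w).toReal) C) :
    HasProx (dom φ) (fun w => (φ w).toReal) := by
  intro x₀ hx₀ R M
  obtain ⟨A, hA⟩ := hgr x₀ hx₀
  set f : X → ℝ := fun w => (φ w).toReal with hf
  set B := |M| + 1 + |A| + 2 * C * R ^ 2 with hB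
  have hB0 : 0 < B := by positivity
  -- With `θ ≥ H`, the term `2C` beats the quadratic decay of `f`, `4B` confines near-minimizers to
  -- distance `1/2`, and `20(1 + |λ|)` gives `λ/8 + θ/20 ≥ 1` in `hpair`.
  set H := 2 * C + 4 * B + 20 * (1 + |lam|) with hH
  have hH0 : 0 < H := by positivity
  refine ⟨1 / (2 * H), by positivity, fun x hx hxR hxM τ hτ0 hτ => ?_⟩
  set θ := 1 / (2 * τ) with hθdef
  have hθ : H ≤ θ := by
    rw [lt_div_iff₀ (by positivity)] at hτ
    rw [hθdef, le_div_iff₀ (by positivity)]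
    linarith
  have hθ0 : 0 < θ := hH0.trans_le hθ
  set F : X → ℝ := fun w => f w + θ * dist x w ^ 2 with hF
  have hlow : ∀ w ∈ dom φ, -(|A| + 2 * C * R ^ 2) + (θ - 2 * C) * dist x w ^ 2 ≤ F w := by
    intro w hw
    have h1 := hA w hw
    have h2 : dist x₀ w ^ 2 ≤ 2 * R ^ 2 + 2 * dist x w ^ 2 := by
      have h3 : dist x₀ w ^ 2 ≤ (R + dist x w) ^ 2 :=
        pow_le_pow_left₀ dist_nonneg (by linarith [dist_triangle x₀ x w]) 2
      nlinarith [sq_nonneg (R - dist x w)]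
    have h3 := mul_le_mul_of_nonneg_left h2 hC.le
    have := le_abs_self A
    simp only [hF]
    linarith
  have hbdd : BddBelow (F '' dom φ) := by
    refine ⟨-(|A| + 2 * C * R ^ 2), ?_⟩
    rintro _ ⟨w, hw, rfl⟩
    have h1 := hlow w hw
    have h2 : 0 ≤ (θ - 2 * C) * dist x w ^ 2 := by
      refine mul_nonneg ?_ (sq_nonneg _)
      have : 0 ≤ |lam| := abs_nonneg _
      linarith
    linarith
  set m := sInf (F '' dom φ) with hm
  have hmle : ∀ w ∈ dom φ, m ≤ F w := fun w hw => csInf_le hbdd ⟨w, hw, rfl⟩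
  have hseq : ∀ n : ℕ, ∃ z ∈ dom φ, F z < m + 1 / ((n : ℝ) + 1) := by
    intro n
    obtain ⟨_, ⟨z, hz, rfl⟩, hlt⟩ := exists_lt_of_csInf_lt (Set.Nonempty.image F ⟨x, hx⟩)
      (show sInf (F '' dom φ) < m + 1 / ((n : ℝ) + 1) by
        rw [← hm]; exact lt_add_of_pos_right _ (by positivity))
    exact ⟨z, hz, hlt⟩
  choose z hzd hzF using hseq
  have hclose : ∀ n, dist x (z n) ≤ 1 / 2 := by
    intro n
    have h1 := hlow _ (hzd n)
    have h2 := hmle x hx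
    have h3 : F x = f x := by simp [hF]
    have h4 : 1 / ((n : ℝ) + 1) ≤ 1 := by
      rw [div_le_one (by positivity)]; linarith [Nat.cast_nonneg (α := ℝ) n]
    have h5 : (θ - 2 * C) * dist x (z n) ^ 2 ≤ B := by
      have := le_abs_self M
      have := hzF n
      linarith
    have h6 : 4 * B * dist x (z n) ^ 2 ≤ (θ - 2 * C) * dist x (z n) ^ 2 := by
      refine mul_le_mul_of_nonneg_right ?_ (sq_nonneg _)
      have : 0 ≤ |lam| := abs_nonneg _
      linarith
    have h7 : dist x (z n) ^ 2 ≤ (1 / 2) ^ 2 := by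
      refine le_of_mul_le_mul_left ?_ hB0
      linarith
    exact (sq_le_sq₀ dist_nonneg (by norm_num)).1 h7
  have hpair : ∀ n k, dist (z n) (z k) ^ 2 ≤ (F (z n) - m + (F (z k) - m)) / 2 := by
    intro n k
    obtain ⟨γ, -, hγ, hγc⟩ := hconv.exists_geodesic hbot (hzd n) (hzd k)
    obtain ⟨h1, h2⟩ := hγc (1 / 2) ⟨by norm_num, by norm_num⟩
    have h3 := h.sq_dist_midpoint_le (hclose n) (hclose k) hγ
    have h4 := hmle _ h1
    have h5 := mul_le_mul_of_nonneg_left h3 hθ0.le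
    have h6 : 1 * dist (z n) (z k) ^ 2 ≤ (lam / 8 + θ / 20) * dist (z n) (z k) ^ 2 := by
      refine mul_le_mul_of_nonneg_right ?_ (sq_nonneg _)
      have := neg_abs_le lam
      have := abs_nonneg lam
      linarith
    simp only [hF, hf] at h4 ⊢
    linarith
  have hcauchy : CauchySeq z := by
    rw [Metric.cauchySeq_iff]
    intro η hη
    obtain ⟨N, hN⟩ := exists_nat_one_div_lt (show 0 < η ^ 2 by positivity)
    refine ⟨N, fun n hn k hk => ?_⟩
    have h1 := hpair n k
    have h2 := hzF n
    have h3 := hzF k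
    have h4 : (1 : ℝ) / (n + 1) ≤ 1 / (N + 1) := Nat.one_div_le_one_div hn
    have h5 : (1 : ℝ) / (k + 1) ≤ 1 / (N + 1) := Nat.one_div_le_one_div hk
    exact lt_of_pow_lt_pow_left₀ 2 hη.le (by linarith)
  obtain ⟨w, hw⟩ := cauchySeq_tendsto_of_complete hcauchy
  -- The limit is not yet known to lie in the domain, so lower semi-continuity is used in `EReal`,
  -- with a real `q` in between.
  have hφw : φ w ≤ ((m - θ * dist x w ^ 2 : ℝ) : EReal) := by
    by_contra hlt
    push Not at hlt
    obtain ⟨q, hq1, hq2⟩ := EReal.lt_iff_exists_real_btwn.1 hlt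
    rw [EReal.coe_lt_coe_iff] at hq1
    have h1 : ∀ᶠ n in atTop, (q : EReal) < φ (z n) := hw.eventually (hlsc w q hq2)
    have h2 : Tendsto (fun n : ℕ => m + 1 / ((n : ℝ) + 1) - θ * dist x (z n) ^ 2) atTop
        (𝓝 (m + 0 - θ * dist x w ^ 2)) :=
      (tendsto_one_div_add_atTop_nhds_zero_nat.const_add m).sub
        (((tendsto_const_nhds.dist hw).pow 2).const_mul θ)
    have h3 : q ≤ m + 0 - θ * dist x w ^ 2 := by
      refine ge_of_tendsto h2 ?_
      filter_upwards [h1] with n hn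
      rw [← coe_toReal_of_mem_dom hbot (hzd n), EReal.coe_lt_coe_iff] at hn
      have := hzF n
      simp only [hF, hf] at this
      linarith
    linarith
  have hwd : w ∈ dom φ := fun htop => by
    rw [htop] at hφw
    exact EReal.coe_ne_top _ (top_le_iff.1 hφw)
  rw [← coe_toReal_of_mem_dom hbot hwd, EReal.coe_le_coe_iff] at hφw
  refine ⟨w, hwd, fun v hv => ?_⟩
  have h1 := hmle v hv
  have e : ∀ d : ℝ, d / (2 * τ) = θ * d := fun d => by rw [hθdef]; ring
  rw [e, e]
  simp only [hF, hf] at h1 ⊢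
  linarith

end MetricFlow

/-! ### The contraction property in both cases -/

theorem theorem4p4 {X : Type*} [MetricSpace X] [CompleteSpace X]
    (φ : X → EReal) (lam : ℝ)
    (hbot : ∀ x, φ x ≠ ⊥) (hlsc : LowerSemicontinuous φ)
    (hcase :
      (MetricFlow.IsCAT1 X ∧ MetricFlow.IsLambdaConvex Set.univ lam φ) ∨
      (∃ (Γ : Set (ℝ → X)) (K : ℝ),
        MetricFlow.IsLambdaConvex Γ lam φ ∧ MetricFlow.SqDistConvex Γ K ∧
        MetricFlow.SqDistCommutes Γ ∧ MetricFlow.IsCoercive φ)) :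
    (∀ x₀ ∈ MetricFlow.dom φ, ∃! ξ : ℝ≥0 → X, MetricFlow.IsGradientCurve φ x₀ ξ) ∧
    ∀ x₀ ∈ MetricFlow.dom φ, ∀ y₀ ∈ MetricFlow.dom φ, ∀ ξ ζ : ℝ≥0 → X,
      MetricFlow.IsGradientCurve φ x₀ ξ → MetricFlow.IsGradientCurve φ y₀ ζ →
      ∀ t : ℝ≥0, 0 < t →
        dist (ξ t) (ζ t) ≤ Real.exp (-lam * (t : ℝ)) * dist x₀ y₀ := by
  -- Both cases enter only through semi-convexity, the local inequality with `r = 1`, and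
  -- solvability of the minimization steps.
  obtain ⟨Γ, K, hK, hconv, hevi, hprox⟩ : ∃ (Γ : Set (ℝ → X)) (K : ℝ), 0 ≤ K ∧
      MetricFlow.IsLambdaConvex Γ lam φ ∧
      MetricFlow.LocalEVI (MetricFlow.dom φ) (fun w => (φ w).toReal) lam 1 K ∧
      MetricFlow.HasProx (MetricFlow.dom φ) (fun w => (φ w).toReal) := by
    rcases hcase with ⟨hcat, hconv⟩ | ⟨Γ, K, hconv, hK, hcomm, hcoer⟩
    · exact ⟨Set.univ, 0, le_rfl, hconv, hcat.localEVI hbot hconv,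
        hcat.hasProx hbot hlsc hconv (by positivity) (hconv.quadraticGrowth hbot hlsc)⟩
    · exact ⟨Γ, |K| / 2, by positivity, hconv, hcomm.localEVI hbot hconv hK 1,
        hcoer.hasProx hbot⟩
  obtain ⟨h1, h2⟩ := hevi.gradientCurve hbot one_pos hK (by positivity)
    (hconv.quadraticGrowth hbot hlsc) hprox fun x hx y hy => by
      obtain ⟨γ, -, hγ, hc⟩ := hconv.exists_geodesic hbot hx hy
      exact ⟨γ, hγ, fun t ht => (hc t ht).1⟩
  exact ⟨h1, fun x₀ hx₀ y₀ hy₀ ξ ζ hξ hζ t _ => h2 x₀ hx₀ y₀ hy₀ ξ ζ hξ hζ t⟩
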